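/- Let $n \ge 2$ be an integer, $p$ a prime, $K$ a global field with separable closure $\overline K$ and $\Gamma_K = \mathrm{Gal}(\overline K/K)$, $S$ a finite set of places of $K$ (archimedean places allowed), and $E$ a finite extension of $\mathbf{Q}_p$ with residue field $k$, where $\gcd(n, |k^\times|) = 1$. Let $K_0 = K$ and, inductively, let $K_{i+1} \subseteq \overline K$ be the maximal abelian extension of $K_i$ that is unramified outside (the places above) $S$ and for which $\mathrm{Gal}(K_{i+1}/K_i)$ is a direct product of copies of $\mathbf{F}_p$. Let $\epsilon = 1$ if $p = 2$ and $\epsilon = 0$ otherwise, let $N = n[E:\mathbf{Q}_p]$ and $r = N^{2(1+\epsilon)} \frac{N(N-1)}{2}$, let $\lambda$ be the least integer with $2^\lambda \ge r$ and $m$ the least integer with $p^m \ge n$, and put $K_S = K_{\lambda+\epsilon+m}$. Two matrices $M_1, M_2 \in \mathcal{M}(n, E)$ are said to have congruent eigenvalues if, for a finite extension $F$ of $E$ containing the eigenvalues of both, with ring of integers $\mathcal{O}_F$, maximal ideal $\mathfrak{p}_F$ and uniformizer $\varpi_F$, there are $\mu \in \mathcal{O}_F^\times$ and $v \in \mathbf{Z}$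 such that the characteristic polynomials of $\varpi_F^{-v} M_1$ and $\varpi_F^{-v} M_2$ lie in $\mathcal{O}_F[X]$ and are congruent to $(X-\mu)^n$ modulo $\mathfrak{p}_F$. Let $T$ be a set of places of $K$, disjoint from $S$, such that each maximal cyclic subgroup of $\mathrm{Gal}(K_S/K)$ has a generator of the form $\mathrm{Frob}(\mathfrak{t}/t)$ for some non-archimedean $t \in T$ and some place $\mathfrak{t}$ of $K_S$ above $t$. Let $\rho_1, \rho_2 : \Gamma_K \to \mathrm{GL}(n, E)$ be continuous representations, unramified outside $S$, such that 1. for every $\sigma \in \Gamma_K$, the matrices $\rho_1(\sigma)$ and $\rho_2(\sigma)$ have congruent eigenvalues; 2. for every non-archimedean $t \in T$ and every Frobenius element $\mathrm{Frob}\, t \in \Gamma_K$ above $t$, the matrices $\rho_1(\mathrm{Frob}\, t)$ and $\rho_2(\mathrm{Frob}\, t)$ have the same characteristic polynomial. Then $\rho_1$ and $\rho_2$ have isomorphic semi-simplifications. -/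

import Mathlib

open scoped Pointwise RatFunc NNReal

universe u v w

noncomputable section

namespace GaloisCriterion

/-! ### Global fields and their places -/

/-- A global field: a number field, or a finite extension of `𝔽_ℓ(t)` for some prime `ℓ`. -/
def IsGlobalField (K : Type u) [Field K] : Prop :=
  NumberField K ∨
    ∃ (ℓ : ℕ) (_ : Fact ℓ.Prime) (_ : Algebra (RatFunc (ZMod ℓ)) K),
      FiniteDimensional (RatFunc (ZMod ℓ)) K

/-- A place of a global field `K`, or of an algebraic extension of such a field. The
non-archimedean places are given by the nontrivial valuation rings of the field, the
archimedean ones by the complex embeddings up to conjugation (there are none in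
positive characteristic). -/
inductive Place (K : Type u) [Field K] : Type u
  | finite (A : ValuationSubring K) (hA : A ≠ ⊤) : Place K
  | infinite (x : NumberField.InfinitePlace K) : Place K

namespace Place

variable (K : Type u) [Field K] {L : Type v} [Field L] [Algebra K L]

variable {K} in
/-- The place `y` of `L` lies above the place `x` of `K`. -/
def LiesOver (y : Place L) (x : Place K) : Prop :=
  match y, x with
  | finite B _, finite A _ => B.comap (algebraMap K L) = A
  | infinite b, infinite a => b.comap (algebraMap K L) = a
  | _, _ => False

/-- The inertia group of a place `y` of `L` in `Gal(L/K)`. For an archimedean place it is the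
decomposition group, i.e. the stabilizer of the place. -/
def inertia (y : Place L) : Subgroup (L ≃ₐ[K] L) :=
  match y with
  | finite B _ => (B.inertiaSubgroup K).map (B.decompositionSubgroup K).subtype
  | infinite b => MulAction.stabilizer (L ≃ₐ[K] L) b

variable {K} in
/-- `σ ∈ Gal(L/K)` is a Frobenius element `Frob(y/x)` of the place `y` of `L` above the
(non-archimedean) place `x` of `K`: it stabilizes `y` and acts on the residue field of `y` as
raising to the power `q`, with `q` the number of elements of the residue field of `x`. -/
def IsFrobenius (y : Place L) (x : Place K) (σ : L ≃ₐ[K] L) : Prop :=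
  match y, x with
  | finite B _, finite A _ =>
      B.comap (algebraMap K L) = A ∧ σ • B = B ∧
        ∀ z ∈ B, σ z - z ^ Nat.card (IsLocalRing.ResidueField A) ∈ B.nonunits
  | _, _ => False

end Place

/-! ### The tower of elementary abelian extensions -/

section Tower

variable {K : Type u} [Field K] {Kb : Type v} [Field Kb] [Algebra K Kb]

/-- The extension `M/F` is Galois, with abelian Galois group killed by `p` (equivalently, with
Galois group a direct product of copies of `𝔽_p`). -/
def IsElementaryAbelian (p : ℕ) (F : IntermediateField K Kb) (M : IntermediateField F Kb) :
    Prop :=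
  IsGalois F M ∧ (∀ σ τ : M ≃ₐ[F] M, σ * τ = τ * σ) ∧ ∀ σ : M ≃ₐ[F] M, σ ^ p = 1

/-- The Galois extension `M/F`, with `K ⊆ F ⊆ M`, is unramified at all places that do not lie
above a place of `K` in `S`. -/
def IsUnramifiedOutside (S : Set (Place K)) (F : IntermediateField K Kb)
    (M : IntermediateField F Kb) : Prop :=
  ∀ x : Place K, x ∉ S → ∀ y : Place M, y.LiesOver x → y.inertia F = ⊥

/-- The maximal extension of `F` inside `Kb` that is abelian with Galois group a product of
copies of `𝔽_p` and that is unramified outside `S`: the compositum of all such extensions. -/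
def maxElementaryAbelian (S : Set (Place K)) (p : ℕ) (F : IntermediateField K Kb) :
    IntermediateField K Kb :=
  (sSup {M : IntermediateField F Kb |
    IsElementaryAbelian p F M ∧ IsUnramifiedOutside S F M}).restrictScalars K

/-- The tower `K = K_0 ⊆ K_1 ⊆ K_2 ⊆ ⋯`. -/
def tower (Kb : Type v) [Field Kb] [Algebra K Kb] (S : Set (Place K)) (p : ℕ) :
    ℕ → IntermediateField K Kb
  | 0 => ⊥
  | i + 1 => maxElementaryAbelian S p (tower Kb S p i)

/-- The number of steps `λ + ε + m`, where `ε = 1` if `p = 2` and `ε = 0` otherwise,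
`r = N ^ (2 * (1 + ε)) * (N * (N - 1) / 2)`, the number `λ` is minimal with `r ≤ 2 ^ λ`,
and `m` is minimal with `n ≤ p ^ m`. -/
def towerHeight (p n N : ℕ) : ℕ :=
  let ε : ℕ := if p = 2 then 1 else 0
  let r : ℕ := N ^ (2 * (1 + ε)) * (N * (N - 1) / 2)
  Nat.clog 2 r + ε + Nat.clog p n

/-- The field `K_S = K_{λ + ε + m}` attached to representations of dimension `n` over
an extension of `ℚ_p` of degree `d`, so that `N = n * d`. -/
def fieldKS (Kb : Type v) [Field Kb] [Algebra K Kb] (S : Set (Place K)) (p n d : ℕ) :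
    IntermediateField K Kb :=
  tower Kb S p (towerHeight p n (n * d))

end Tower

/-! ### Finite extensions of `ℚ_p` and congruent eigenvalues -/

section Local

/-- The ring of integers of a finite extension `E` of `ℚ_p`, where the norm of `E` is the
one extending the norm of `ℚ_p`: the elements of norm at most one. -/
def ringOfIntegers (p : ℕ) [Fact p.Prime] (E : Type u) [NormedField E] [NormedAlgebra ℚ_[p] E] :
    ValuationSubring E :=
  haveI : IsUltrametricDist E := IsUltrametricDist.of_normedAlgebra ℚ_[p]
  (NormedField.valuation (K := E)).valuationSubring

theorem mem_ringOfIntegers (p : ℕ) [Fact p.Prime] (E : Type u) [NormedField E]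
    [NormedAlgebra ℚ_[p] E] (x : E) : x ∈ ringOfIntegers p E ↔ ‖x‖ ≤ 1 := by
  have h : IsUltrametricDist E := IsUltrametricDist.of_normedAlgebra ℚ_[p]
  exact Iff.rfl

/-- The residue field of a finite extension `E` of `ℚ_p`. -/
abbrev residueField (p : ℕ) [Fact p.Prime] (E : Type u) [NormedField E] [NormedAlgebra ℚ_[p] E] :
    Type u :=
  IsLocalRing.ResidueField (ringOfIntegers p E)

/-- `ϖ` generates the maximal ideal `{x | ‖x‖ < 1}` of the ring of integers `{x | ‖x‖ ≤ 1}`. -/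
def IsUniformizer {F : Type u} [NormedField F] (ϖ : F) : Prop :=
  ϖ ≠ 0 ∧ ‖ϖ‖ < 1 ∧ ∀ x : F, ‖x‖ < 1 → ‖x‖ ≤ ‖ϖ‖

/-- A polynomial over `F` has integral coefficients and is congruent to `(X - l) ^ n`
modulo the maximal ideal of the ring of integers of `F`. -/
def IsCongruentToPow {F : Type u} [NormedField F] (P : Polynomial F) (l : F) (n : ℕ) : Prop :=
  (∀ j, ‖P.coeff j‖ ≤ 1) ∧
    ∀ j, ‖(P - (Polynomial.X - Polynomial.C l) ^ n).coeff j‖ < 1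

/-- Two matrices over a finite extension `E` of `ℚ_p` have congruent eigenvalues: over a
finite extension `F` of `E` that contains the eigenvalues of both, with uniformizer `ϖ`, there
are a unit `l` of the ring of integers and an integer `a` such that the characteristic
polynomials of `ϖ ^ (-a) M₁` and `ϖ ^ (-a) M₂` are integral and congruent to `(X - l) ^ n`. -/
def CongruentEigenvalues {E : Type u} [NormedField E] {n : ℕ}
    (M₁ M₂ : Matrix (Fin n) (Fin n) E) : Prop :=
  ∃ (F : Type u) (_ : NormedField F) (_ : NormedAlgebra E F) (_ : FiniteDimensional E F),
    (M₁.charpoly.map (algebraMap E F)).Splits ∧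
    (M₂.charpoly.map (algebraMap E F)).Splits ∧
    ∃ ϖ : F, IsUniformizer ϖ ∧ ∃ (l : F) (a : ℤ), ‖l‖ = 1 ∧
      IsCongruentToPow (ϖ ^ (-a) • M₁.map (algebraMap E F)).charpoly l n ∧
      IsCongruentToPow (ϖ ^ (-a) • M₂.map (algebraMap E F)).charpoly l n

end Local

/-! ### Representations -/

section Representations

/-- `ρ` is unramified outside `S`: it is trivial on the inertia group of each place of `Kb`
above a place of `K` that is not in `S`. -/
def IsUnramifiedRep {K : Type u} [Field K] {Kb : Type v} [Field Kb] [Algebra K Kb]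
    {H : Type w} [Group H] (S : Set (Place K)) (ρ : (Kb ≃ₐ[K] Kb) →* H) : Prop :=
  ∀ x : Place K, x ∉ S → ∀ y : Place Kb, y.LiesOver x → y.inertia K ≤ ρ.ker

/-- The linear representation on `E ^ n` given by a homomorphism to `GL(n, E)`. -/
def toRep {G : Type v} [Group G] {E : Type u} [Field E] {n : ℕ}
    (ρ : G →* GL (Fin n) E) : Representation E G (Fin n → E) :=
  ((Matrix.toLinAlgEquiv' (R := E) (n := Fin n) :
      Matrix (Fin n) (Fin n) E →* Module.End E (Fin n → E))).comp
    ((Units.coeHom (Matrix (Fin n) (Fin n) E)).comp ρ)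

/-- The graded module of a composition series `s`: the direct sum of the simple quotients of
successive terms. -/
abbrev gradedModule {A : Type u} [Ring A] {V : Type v} [AddCommGroup V] [Module A V]
    (s : CompositionSeries (Submodule A V)) : Type v :=
  ∀ i : Fin s.length,
    (s i.succ : Submodule A V) ⧸ (s i.castSucc).submoduleOf (s i.succ)

/-- The modules `V` and `W` have isomorphic semi-simplifications, where a semi-simplification is
the graded module of a composition series of the whole module (unique up to isomorphism by the
Jordan–Hölder theorem). -/
def IsoSemisimplifications (A : Type u) [Ring A] (V : Type v) [AddCommGroup V] [Module A V]
    (W : Type w) [AddCommGroup W] [Module A W] : Prop :=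
  ∃ (s : CompositionSeries (Submodule A V)) (t : CompositionSeries (Submodule A W)),
    s.head = ⊥ ∧ s.last = ⊤ ∧ t.head = ⊥ ∧ t.last = ⊤ ∧
      Nonempty (gradedModule s ≃ₗ[A] gradedModule t)

end Representations

end GaloisCriterion

end

/-! Write `O` for the ring of integers of `E`, `m` for its maximal ideal and `k` for its residue
field. Since `Γ_K` is compact, the determinant of `ρ₁` has norm one, so the scaling exponent in the
definition of congruent eigenvalues must be zero, and the characteristic polynomials of `ρ₁(g)` and
`ρ₂(g)` both reduce to `(X - χ(g))^n` with `χ(g) ∈ kˣ`. Now `χ^n` is the reduced determinant and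
raising to the power `n` is injective on `kˣ`, so `χ` is a character (`exists_residual_character`).

The image of `(ρ₁, ρ₂)` spans over `O` an order `A` in a product of two matrix algebras, of rank at
most `2n²`. In `R = k ⊗ A` the images of the group elements, divided by `χ`, are unipotent elements
`f(g)` that span `R`. A fixed point argument for `p`-groups shows that the ideal `I` spanned by the
`f(g) - 1` satisfies `I^(2n²) = 0` (`augmentation_pow_finrank`). Let `U i` consist of the `g` with
`f(g) - 1 ∈ I^(2^i)`. Commutators and `p`-th powers of elements of `U i` lie in `U (i + 1)`. These
subgroups are closed and contain the inertia outside `S`, so by Galois theory `U i` contains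
`Gal(Kb/K_i)` (`fixingSubgroup_tower_le`). The tower is high enough for its top group to lie in the
kernel of `f`.

Modulo `Gal(Kb/K_S)` every `g` is a power `F^j` of a Frobenius element above `T`, so the image of
`g` in `A` is congruent modulo `mA` to a multiple of that of `F^j`. The difference `δ` of the two
traces vanishes at `F^j`, because the characteristic polynomial of a matrix determines the traces of
its powers. Hence `δ(A) ⊆ m δ(A)` and Nakayama gives `δ = 0` (`exists_unipotent_subgroups`).
Finally, in characteristic zero, traces determine the semi-simplification
(`exists_equiv_of_moduleTrace_eq`, by Jacobson density). -/

namespace GaloisCriterion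

/-! ### Unipotent groups spanning a finite algebra -/

section Unipotent

variable {k R G : Type*} [Field k] [Ring R] [Algebra k R] [Group G] (f : G →* Rˣ)

/-- The image of the augmentation ideal under the linear extension of `f : G →* Rˣ`. -/
def augmentation (k : Type*) {R G : Type*} [Field k] [Ring R] [Algebra k R] [Group G]
    (f : G →* Rˣ) : Submodule k R :=
  Submodule.span k (Set.range fun g => (f g : R) - 1)

variable {f}

theorem mem_augmentation (g : G) : (f g : R) - 1 ∈ augmentation k f :=
  Submodule.subset_span ⟨g, rfl⟩

theorem top_mul_augmentation (hf : Submodule.span k (Set.range fun g => (f g : R)) = ⊤) :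
    ⊤ * augmentation k f ≤ augmentation k f := by
  rw [← hf, augmentation, Submodule.span_mul_span, Submodule.span_le]
  rintro _ ⟨_, ⟨g, rfl⟩, _, ⟨h, rfl⟩, rfl⟩
  have : (f g : R) * ((f h : R) - 1) = ((f (g * h) : R) - 1) - ((f g : R) - 1) := by
    simp [mul_sub]
  simp only [SetLike.mem_coe, this]
  exact sub_mem (mem_augmentation _) (mem_augmentation _)

theorem augmentation_mul_top (hf : Submodule.span k (Set.range fun g => (f g : R)) = ⊤) :
    augmentation k f * ⊤ ≤ augmentation k f := by
  rw [← hf, augmentation, Submodule.span_mul_span, Submodule.span_le]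
  rintro _ ⟨_, ⟨g, rfl⟩, _, ⟨h, rfl⟩, rfl⟩
  have : ((f g : R) - 1) * (f h : R) = ((f (g * h) : R) - 1) - ((f h : R) - 1) := by
    simp [sub_mul]
  simp only [SetLike.mem_coe, this]
  exact sub_mem (mem_augmentation _) (mem_augmentation _)

/-- The exponent zero is an exception because the zeroth power of a submodule is `k · 1`, which need
not be an ideal. -/
theorem top_mul_augmentation_pow (hf : Submodule.span k (Set.range fun g => (f g : R)) = ⊤)
    (j : ℕ) : ⊤ * augmentation k f ^ j ≤ augmentation k f ^ j ∨ j = 0 := by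
  cases j with
  | zero => exact .inr rfl
  | succ j =>
    left
    rw [pow_succ', ← mul_assoc]
    exact mul_le_mul_left (top_mul_augmentation hf) _

theorem augmentation_pow_mul_mem (hf : Submodule.span k (Set.range fun g => (f g : R)) = ⊤)
    {j : ℕ} (hj : j ≠ 0) {x : R} (hx : x ∈ augmentation k f ^ j) (r : R) :
    x * r ∈ augmentation k f ^ j := by
  obtain ⟨j, rfl⟩ := Nat.exists_eq_succ_of_ne_zero hj
  have h : augmentation k f ^ (j + 1) * ⊤ ≤ augmentation k f ^ (j + 1) := by
    rw [pow_succ, mul_assoc]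
    exact mul_le_mul_right (augmentation_mul_top hf) _
  exact h (Submodule.mul_mem_mul hx trivial)

theorem mul_augmentation_pow_mem (hf : Submodule.span k (Set.range fun g => (f g : R)) = ⊤)
    {j : ℕ} (hj : j ≠ 0) {x : R} (hx : x ∈ augmentation k f ^ j) (r : R) :
    r * x ∈ augmentation k f ^ j :=
  ((top_mul_augmentation_pow hf j).resolve_right hj) (Submodule.mul_mem_mul trivial hx)

/-- The left ideal of elements annihilated by the `j`-th power of the augmentation ideal. -/
def augmentationAnnihilator (k : Type*) {R G : Type*} [Field k] [Ring R] [Algebra k R] [Group G]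
    (f : G →* Rˣ) (j : ℕ) :
    Submodule R R where
  -- The factor `r` makes this a left ideal with no condition on `f`. For `j = 0` it also gives the
  -- zero ideal, as `1` lies in the zeroth power.
  carrier := {a | ∀ x ∈ augmentation k f ^ j, ∀ r : R, x * (r * a) = 0}
  add_mem' ha hb x hx r := by rw [mul_add, mul_add, ha x hx, hb x hx, add_zero]
  zero_mem' := by simp
  smul_mem' c a ha x hx r := by
    rw [smul_eq_mul, ← mul_assoc r c]; exact ha x hx _

/-- The range of `f` is a `p`-group acting on the nonzero finite quotient `R ⧸ W`, whose order is
divisible by `p`. Besides `0` there is thus another fixed point, the class of some `a ∉ W`. Then `(f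
g - 1) * a ∈ W` for all `g`, which puts `a` into the next annihilator. -/
theorem augmentationAnnihilator_lt (p : ℕ) [Fact p.Prime] [CharP R p] [Finite R]
    (hf : Submodule.span k (Set.range fun g => (f g : R)) = ⊤)
    (hn : ∀ g, IsNilpotent ((f g : R) - 1)) (j : ℕ) (hj : augmentationAnnihilator k f j ≠ ⊤) :
    augmentationAnnihilator k f j < augmentationAnnihilator k f (j + 1) := by
  set W := augmentationAnnihilator k f j with hW
  -- In characteristic `p`, `u ^ p ^ m - 1 = (u - 1) ^ p ^ m`, which vanishes once `(u - 1) ^ m =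
  -- 0`, since `m < p ^ m`.
  have hP : IsPGroup p f.range := by
    rintro ⟨_, g, rfl⟩
    obtain ⟨m, hm⟩ := hn g
    refine ⟨m, Subtype.ext (Units.ext ?_)⟩
    have h1 : ((f g : R) - 1) ^ p ^ m = 0 :=
      pow_eq_zero_of_le (Nat.lt_pow_self (Fact.out (p := p.Prime)).one_lt).le hm
    rw [sub_pow_char_pow_of_commute p m (Commute.one_right _), one_pow, sub_eq_zero] at h1
    simpa using h1
  have hQ : Nontrivial (R ⧸ W) := Submodule.Quotient.nontrivial_iff.mpr hj
  have hfin : Finite (R ⧸ W) := Quotient.finite _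
  obtain ⟨x, hx⟩ := exists_ne (0 : R ⧸ W)
  have hp : p ∣ Nat.card (R ⧸ W) := by
    have h1 : addOrderOf x = p := by
      refine addOrderOf_eq_prime ?_ hx
      rw [← Nat.cast_smul_eq_nsmul R, CharP.cast_eq_zero, zero_smul]
    exact h1 ▸ addOrderOf_dvd_natCard x
  obtain ⟨b, hb, hb0⟩ := hP.exists_fixed_point_of_prime_dvd_card_of_fixed_point (R ⧸ W) hp
    (a := 0) (by intro g; exact smul_zero _)
  obtain ⟨a, rfl⟩ := Submodule.Quotient.mk_surjective _ b
  have ha : ∀ y ∈ augmentation k f, y * a ∈ W := by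
    intro y hy
    induction hy using Submodule.span_induction with
    | mem y hy =>
      obtain ⟨g, rfl⟩ := hy
      have h1 := hb ⟨f g, g, rfl⟩
      have h2 : Submodule.Quotient.mk (p := W) ((f g : R) * a) = Submodule.Quotient.mk a := h1
      rw [Submodule.Quotient.eq] at h2
      simpa [sub_mul] using h2
    | zero => simp
    | add y z _ _ hy hz => rw [add_mul]; exact add_mem hy hz
    | smul c y _ hy =>
      rw [Algebra.smul_def, mul_assoc]
      exact W.smul_mem _ hy
  refine lt_of_le_of_ne ?_ ?_
  · intro c hc x hx r
    rw [pow_succ'] at hx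
    induction hx using Submodule.mul_induction_on' with
    | mem_mul_mem m _ n hn =>
      rw [mul_assoc, hc n hn, mul_zero]
    | add x _ y _ hx hy => rw [add_mul, hx, hy, add_zero]
  · intro heq
    have haW : a ∈ augmentationAnnihilator k f (j + 1) := by
      intro x hx r
      rw [pow_succ] at hx
      induction hx using Submodule.mul_induction_on' with
      | mem_mul_mem m hm y hy =>
        have h1 : y * r ∈ augmentation k f := by
          simpa using augmentation_pow_mul_mem hf one_ne_zero (by simpa using hy) r
        have h2 := ha _ h1 m hm 1
        rwa [one_mul, mul_assoc, ← mul_assoc] at h2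
      | add x _ y _ hx hy => rw [add_mul, hx, hy, add_zero]
    rw [← heq] at haW
    exact hb0 ((Submodule.Quotient.mk_eq_zero W).mpr haW).symm

/-- The annihilators grow by at least one dimension at each step until they fill `R`; an annihilator
containing `1` means that the power itself is zero. -/
theorem augmentation_pow_finrank (p : ℕ) [Fact p.Prime] [CharP R p] [Finite R]
    (hf : Submodule.span k (Set.range fun g => (f g : R)) = ⊤)
    (hn : ∀ g, IsNilpotent ((f g : R) - 1)) {d : ℕ} (hd : Module.finrank k R ≤ d) :
    augmentation k f ^ d = ⊥ := by
  have hfd : FiniteDimensional k R := inferInstance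
  have key : ∀ j, augmentationAnnihilator k f j = ⊤ ∨
      j ≤ Module.finrank k ((augmentationAnnihilator k f j).restrictScalars k) := by
    intro j
    induction j with
    | zero => exact .inr (Nat.zero_le _)
    | succ j ih =>
      by_cases h : augmentationAnnihilator k f j = ⊤
      · left
        by_contra h1
        have := augmentationAnnihilator_lt p hf hn _ h1
        have h2 : augmentationAnnihilator k f j ≤ augmentationAnnihilator k f (j + 1) := by
          intro c hc x hx r
          rw [pow_succ'] at hx
          induction hx using Submodule.mul_induction_on' with
          | mem_mul_mem m _ n hn =>
            rw [mul_assoc, hc n hn, mul_zero]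
          | add x _ y _ hx hy => rw [add_mul, hx, hy, add_zero]
        exact h1 (top_le_iff.mp (h ▸ h2))
      · right
        have h1 := augmentationAnnihilator_lt p hf hn _ h
        have h2 : (augmentationAnnihilator k f j).restrictScalars k <
            (augmentationAnnihilator k f (j + 1)).restrictScalars k :=
          (Submodule.restrictScalars_lt (S := k)).mpr h1
        exact (ih.resolve_left h).trans_lt (Submodule.finrank_lt_finrank_of_lt h2)
  have htop : augmentationAnnihilator k f d = ⊤ := by
    rcases key d with h | h
    · exact h
    · have h1 : (augmentationAnnihilator k f d).restrictScalars k = ⊤ :=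
        Submodule.eq_top_of_finrank_eq (le_antisymm (Submodule.finrank_le _) (hd.trans h))
      exact (Submodule.restrictScalars_eq_top_iff k R R).mp h1
  rw [eq_bot_iff]
  intro x hx
  have : (1 : R) ∈ augmentationAnnihilator k f d := htop ▸ trivial
  simpa using this x hx 1

/-- The subgroup of elements that act trivially modulo the `2 ^ i`-th power of the
augmentation ideal. -/
def unipotentFiltration (hf : Submodule.span k (Set.range fun g => (f g : R)) = ⊤) (i : ℕ) :
    Subgroup G where
  carrier := {g | (f g : R) - 1 ∈ augmentation k f ^ 2 ^ i}
  one_mem' := by simp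
  mul_mem' {g h} hg hh := by
    have : (f (g * h) : R) - 1 = (f g : R) * ((f h : R) - 1) + ((f g : R) - 1) := by
      simp [mul_sub]
    simp only [Set.mem_ofPred_eq, this] at *
    exact add_mem (mul_augmentation_pow_mem hf (by positivity) hh _) hg
  inv_mem' {g} hg := by
    have : (f g⁻¹ : R) - 1 = -((f g⁻¹ : R) * ((f g : R) - 1)) := by
      simp [mul_sub]
    simp only [Set.mem_ofPred_eq, this] at *
    exact neg_mem (mul_augmentation_pow_mem hf (by positivity) hg _)

variable (hf : Submodule.span k (Set.range fun g => (f g : R)) = ⊤)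

theorem mem_unipotentFiltration {i : ℕ} {g : G} :
    g ∈ unipotentFiltration hf i ↔ (f g : R) - 1 ∈ augmentation k f ^ 2 ^ i := Iff.rfl

theorem unipotentFiltration_zero : unipotentFiltration hf 0 = ⊤ := by
  refine top_le_iff.mp fun g _ => ?_
  simpa [mem_unipotentFiltration] using mem_augmentation g

/-- With `a = f g` and `b = f h`, one has `a b a⁻¹ b⁻¹ - 1 = ((a - 1)(b - 1) - (b - 1)(a - 1)) (b
a)⁻¹`. The right side is quadratic in the augmentation, which is why the exponents `2 ^ i` double.
-/
theorem commutator_mem_unipotentFiltration {i : ℕ} {g h : G}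
    (hg : g ∈ unipotentFiltration hf i) (hh : h ∈ unipotentFiltration hf i) :
    (g * h * g⁻¹ * h⁻¹) ∈ unipotentFiltration hf (i + 1) := by
  rw [mem_unipotentFiltration] at *
  have key : (f (g * h * g⁻¹ * h⁻¹) : R) - 1 = (((f g : R) - 1) * ((f h : R) - 1) -
      ((f h : R) - 1) * ((f g : R) - 1)) * ((f (h * g)⁻¹ : Rˣ) : R) := by
    have h1 : (f (g * h * g⁻¹ * h⁻¹) : R) = (f g : R) * (f h : R) * ((f (h * g)⁻¹ : Rˣ) : R) := by
      simp [mul_assoc]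
    have h2 : (f h : R) * (f g : R) * ((f (h * g)⁻¹ : Rˣ) : R) = 1 := by
      rw [← Units.val_mul, ← map_mul, ← Units.val_mul, ← map_mul]; simp
    rw [h1]
    conv_lhs => rw [← h2]
    noncomm_ring
  rw [key, pow_succ 2 i, mul_two, pow_add]
  have h3 := sub_mem (Submodule.mul_mem_mul hg hh) (Submodule.mul_mem_mul hh hg)
  rw [← pow_add] at h3 ⊢
  exact augmentation_pow_mul_mem hf (by positivity) h3 _

/-- In characteristic `p`, `f (g ^ p) - 1 = (f g - 1) ^ p`, and `p ≥ 2` already doubles the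
exponent. -/
theorem pow_mem_unipotentFiltration (p : ℕ) [Fact p.Prime] [CharP R p] {i : ℕ} {g : G}
    (hg : g ∈ unipotentFiltration hf i) : g ^ p ∈ unipotentFiltration hf (i + 1) := by
  rw [mem_unipotentFiltration] at *
  have h1 : (f (g ^ p) : R) - 1 = ((f g : R) - 1) ^ p := by
    rw [sub_pow_char_of_commute p (Commute.one_right _)]; simp
  obtain ⟨q, hq⟩ := Nat.exists_eq_add_of_le (Fact.out (p := p.Prime)).two_le
  rw [h1, hq, pow_add _ 2 q]
  have h3 : ((f g : R) - 1) ^ 2 ∈ (augmentation k f ^ 2 ^ i) ^ 2 := Submodule.pow_mem_pow _ hg _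
  rw [← pow_mul, ← pow_succ] at h3
  exact augmentation_pow_mul_mem hf (by positivity) h3 _

end Unipotent

/-! ### Traces of powers -/

section TracePow

open Module

theorem trace_pow_of_isNilpotent_sub {F V : Type*} [Field F] [AddCommGroup V] [Module F V]
    [FiniteDimensional F V] {f : End F V} {c : F} (hf : IsNilpotent (f - algebraMap F _ c))
    (j : ℕ) : LinearMap.trace F V (f ^ j) = c ^ j * finrank F V := by
  induction j with
  | zero => simp
  | succ j ih =>
    rw [pow_succ, Module.End.mul_eq_comp, LinearMap.trace_comp_eq_mul_of_commute_of_isNilpotent c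
      (Commute.pow_self f j) hf, ih, pow_succ']
    ring

/-- The trace of `f ^ j` is the sum of the `j`-th powers of the eigenvalues, counted with the
dimensions of the generalized eigenspaces, which are the root multiplicities of the characteristic
polynomial. -/
theorem trace_pow_eq_of_charpoly_eq_of_isAlgClosed {F V : Type*} [Field F] [IsAlgClosed F]
    [AddCommGroup V] [Module F V] [FiniteDimensional F V] {f g : End F V}
    (h : f.charpoly = g.charpoly) (j : ℕ) :
    LinearMap.trace F V (f ^ j) = LinearMap.trace F V (g ^ j) := by
  classical
  have key : ∀ f : End F V, LinearMap.trace F V (f ^ j) =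
      ∑ c ∈ f.charpoly.roots.toFinset, c ^ j * (f.charpoly.rootMultiplicity c : F) := by
    intro f
    have hds := DirectSum.isInternal_submodule_of_iSupIndep_of_iSup_eq_top
      f.independent_maxGenEigenspace (End.iSup_maxGenEigenspace_eq_top f)
    have hfin : {c | f.maxGenEigenspace c ≠ ⊥}.Finite :=
      WellFoundedGT.finite_ne_bot_of_iSupIndep f.independent_maxGenEigenspace
    have hm : ∀ c, Set.MapsTo f (f.maxGenEigenspace c) (f.maxGenEigenspace c) :=
      fun c => f.mapsTo_maxGenEigenspace_of_comm rfl c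
    have hmj : ∀ c, Set.MapsTo (f ^ j : End F V) (f.maxGenEigenspace c) (f.maxGenEigenspace c) :=
      fun c => f.mapsTo_maxGenEigenspace_of_comm ((Commute.refl f).pow_right j) c
    rw [LinearMap.trace_eq_sum_trace_restrict' hds hfin hmj]
    have hset : hfin.toFinset = f.charpoly.roots.toFinset := by
      ext c
      have h0 : f.charpoly ≠ 0 := f.charpoly_monic.ne_zero
      rw [Set.Finite.mem_toFinset, Multiset.mem_toFinset, ← Multiset.count_pos,
        Polynomial.count_roots, ← LinearMap.finrank_maxGenEigenspace_eq, Set.mem_ofPred_eq,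
        Module.finrank_pos_iff, Submodule.nontrivial_iff_ne_bot]
    rw [hset]
    refine Finset.sum_congr rfl fun c _ => ?_
    rw [← Module.End.pow_restrict (h := hm c), ← LinearMap.finrank_maxGenEigenspace_eq]
    apply trace_pow_of_isNilpotent_sub
    exact f.isNilpotent_restrict_maxGenEigenspace_sub_algebraMap c
  rw [key, key, h]

theorem trace_pow_eq_of_charpoly_eq {E : Type*} [Field E] {n : Type*} [Fintype n] [DecidableEq n]
    {M M' : Matrix n n E} (h : M.charpoly = M'.charpoly) (j : ℕ) :
    (M ^ j).trace = (M' ^ j).trace := by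
  set φ := algebraMap E (AlgebraicClosure E)
  have key : ∀ M : Matrix n n E, φ (M ^ j).trace =
      LinearMap.trace _ _ ((Matrix.toLin' (M.map φ)) ^ j) := by
    intro M
    rw [← Matrix.toLin'_pow, Matrix.trace_toLin'_eq]
    change _ = Matrix.trace ((φ.mapMatrix M) ^ j)
    rw [← map_pow]
    exact AddMonoidHom.map_trace φ _
  apply φ.injective
  rw [key, key]
  apply trace_pow_eq_of_charpoly_eq_of_isAlgClosed
  rw [Matrix.charpoly_toLin', Matrix.charpoly_toLin', Matrix.charpoly_map, Matrix.charpoly_map, h]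

end TracePow

/-! ### Modules in characteristic zero are determined up to semi-simplification by traces -/

section Trace

variable {E A : Type*} [Field E] [Ring A] [Algebra E A]

/-- The trace over `E` of the action of an element of an `E`-algebra on a module. -/
noncomputable def moduleTrace (E : Type*) {A : Type*} [Field E] [Ring A] [Algebra E A] (V : Type*)
    [AddCommGroup V] [Module A V] [Module E V] [IsScalarTower E A V] (a : A) : E :=
  LinearMap.trace E V (Algebra.lsmul E E V a)

variable {V W : Type*} [AddCommGroup V] [Module A V] [Module E V] [IsScalarTower E A V]
  [AddCommGroup W] [Module A W] [Module E W] [IsScalarTower E A W]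

theorem moduleTrace_congr (e : V ≃ₗ[A] W) (a : A) : moduleTrace E V a = moduleTrace E W a := by
  rw [moduleTrace, moduleTrace, ← LinearMap.trace_conj' _ (e.restrictScalars E)]
  congr 1
  ext w
  simp [LinearEquiv.conj_apply]

/-- Linear splittings `r`, `s` write `f` as a sum of two composites through `U` and `Q`; exchanging
the factors under the trace turns them into `fU` and `fQ`. -/
theorem trace_eq_add_of_exact {U V Q : Type*} [AddCommGroup U] [Module E U]
    [AddCommGroup V] [Module E V] [AddCommGroup Q] [Module E Q] [FiniteDimensional E U]
    [FiniteDimensional E V] [FiniteDimensional E Q]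
    {i : U →ₗ[E] V} {q : V →ₗ[E] Q} (hi : Function.Injective i) (hq : Function.Surjective q)
    (hiq : Function.Exact i q) {f : V →ₗ[E] V} {fU : U →ₗ[E] U} {fQ : Q →ₗ[E] Q}
    (hfU : f ∘ₗ i = i ∘ₗ fU) (hfQ : fQ ∘ₗ q = q ∘ₗ f) :
    LinearMap.trace E V f = LinearMap.trace E U fU + LinearMap.trace E Q fQ := by
  obtain ⟨r, hr⟩ := i.exists_leftInverse_of_injective (LinearMap.ker_eq_bot.mpr hi)
  obtain ⟨s, hs⟩ := q.exists_rightInverse_of_surjective (LinearMap.range_eq_top.mpr hq)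
  have hr' : ∀ x, r (i x) = x := fun x => LinearMap.congr_fun hr x
  have hs' : ∀ x, q (s x) = x := fun x => LinearMap.congr_fun hs x
  have hsplit : ∀ v, v = i (r (v - s (q v))) + s (q v) := by
    intro v
    obtain ⟨x, hx⟩ := (hiq (v - s (q v))).mp (by rw [map_sub, hs', sub_self])
    rw [← hx, hr', hx, sub_add_cancel]
  have hdec : f = (f ∘ₗ i) ∘ₗ (r ∘ₗ (LinearMap.id - s ∘ₗ q)) + (f ∘ₗ s) ∘ₗ q := by
    ext v
    conv_lhs => rw [hsplit v]
    simp
  have h1 : (r ∘ₗ (LinearMap.id - s ∘ₗ q)) ∘ₗ (f ∘ₗ i) = fU := by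
    ext x
    simp [hfU, hr', hiq.apply_apply_eq_zero]
  have h2 : q ∘ₗ (f ∘ₗ s) = fQ := by
    rw [← LinearMap.comp_assoc, ← hfQ, LinearMap.comp_assoc, hs, LinearMap.comp_id]
  rw [← h1, ← h2]
  conv_lhs => rw [hdec]
  rw [map_add, LinearMap.trace_comp_comm' (f ∘ₗ i), LinearMap.trace_comp_comm' (f ∘ₗ s)]

theorem moduleTrace_eq_add_quotient (U : Submodule A V) [FiniteDimensional E V]
    [FiniteDimensional E U] [FiniteDimensional E (V ⧸ U)] (a : A) :
    moduleTrace E V a = moduleTrace E U a + moduleTrace E (V ⧸ U) a :=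
  trace_eq_add_of_exact (i := U.subtype.restrictScalars E) (q := U.mkQ.restrictScalars E)
    Subtype.val_injective U.mkQ_surjective (LinearMap.exact_subtype_mkQ U) rfl rfl

theorem finiteDimensional_subquotient [FiniteDimensional E V] (U : Submodule A V)
    (U' : Submodule A U) : FiniteDimensional E (U ⧸ U') := by
  have : FiniteDimensional E U := inferInstanceAs (FiniteDimensional E (U.restrictScalars E))
  exact Module.Finite.of_surjective (U'.mkQ.restrictScalars E) U'.mkQ_surjective

theorem moduleTrace_compositionSeries [FiniteDimensional E V]
    (s : CompositionSeries (Submodule A V)) (h0 : s.head = ⊥) (h1 : s.last = ⊤) (a : A) :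
    moduleTrace E V a = ∑ i : Fin s.length, moduleTrace E
      ((s i.succ : Submodule A V) ⧸ (s i.castSucc).submoduleOf (s i.succ)) a := by
  have hf : ∀ U : Submodule A V, FiniteDimensional E U := fun U =>
    inferInstanceAs (FiniteDimensional E (U.restrictScalars E))
  have hf' : ∀ (U : Submodule A V) (U' : Submodule A U), FiniteDimensional E U' := fun U U' =>
    inferInstanceAs (FiniteDimensional E (U'.restrictScalars E))
  have hfq : ∀ (U : Submodule A V) (U' : Submodule A U), FiniteDimensional E (U ⧸ U') :=
    fun U U' => finiteDimensional_subquotient U U'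
  -- Partial sums are written with an indicator over a fixed index set, so that the induction never
  -- changes the type of the index.
  have key : ∀ i : Fin (s.length + 1), moduleTrace E (s i : Submodule A V) a =
      ∑ j : Fin s.length, if j.castSucc < i then moduleTrace E
        ((s j.succ : Submodule A V) ⧸ (s j.castSucc).submoduleOf (s j.succ)) a else 0 := by
    intro i
    induction i using Fin.induction with
    | zero =>
      have : s 0 = ⊥ := h0
      rw [this]
      simp only [not_lt_zero, if_false, Finset.sum_const_zero, moduleTrace]
      have : Algebra.lsmul E E (⊥ : Submodule A V) a = 0 := Subsingleton.elim _ _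
      rw [this, map_zero]
    | succ i ih =>
      rw [moduleTrace_eq_add_quotient ((s i.castSucc).submoduleOf (s i.succ)),
        moduleTrace_congr (Submodule.submoduleOfEquivOfLe (s.step i).le), ih]
      have hsum : ∀ j : Fin s.length, (if j.castSucc < i.succ then moduleTrace E
          ((s j.succ : Submodule A V) ⧸ (s j.castSucc).submoduleOf (s j.succ)) a else 0) =
          (if j.castSucc < i.castSucc then moduleTrace E
          ((s j.succ : Submodule A V) ⧸ (s j.castSucc).submoduleOf (s j.succ)) a else 0) +
          (if j = i then moduleTrace E
          ((s j.succ : Submodule A V) ⧸ (s j.castSucc).submoduleOf (s j.succ)) a else 0) := by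
        intro j
        simp only [Fin.castSucc_lt_succ_iff, Fin.castSucc_lt_castSucc_iff]
        rcases lt_trichotomy j i with h | h | h
        · simp [h, h.le, h.ne]
        · simp [h]
        · simp [h.not_ge, h.not_gt, h.ne']
      simp_rw [hsum, Finset.sum_add_distrib]
      simp
  have h2 := key (Fin.last _)
  have h3 : s (Fin.last _) = ⊤ := h1
  simp only [Fin.castSucc_lt_last, if_true] at h2
  rw [← h2, h3]
  exact (moduleTrace_congr Submodule.topEquiv a).symm

/-- Over an algebra, there is an element acting as the identity on the members of a finite family
of simple modules that are isomorphic to a given one, and as zero on the other members. -/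
theorem exists_smul_eq_ite {ι : Type*} [Finite ι] (X : ι → Type*) [∀ i, AddCommGroup (X i)]
    [∀ i, Module A (X i)] [∀ i, Module E (X i)] [∀ i, IsScalarTower E A (X i)]
    [∀ i, IsSimpleModule A (X i)] [∀ i, FiniteDimensional E (X i)]
    (S : Type*) [AddCommGroup S] [Module A S] :
    ∃ a : A, ∀ i, (Nonempty (X i ≃ₗ[A] S) → ∀ x : X i, a • x = x) ∧
      (¬ Nonempty (X i ≃ₗ[A] S) → ∀ x : X i, a • x = 0) := by
  classical
  have := Fintype.ofFinite ι
  -- `f₀` is the projection onto the factors isomorphic to `S`.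
  obtain ⟨f₀, hf₀⟩ : ∃ f₀ : (∀ i, X i) →ₗ[A] (∀ i, X i),
      ∀ x i, f₀ x i = if Nonempty (X i ≃ₗ[A] S) then x i else 0 := by
    refine ⟨LinearMap.pi fun i =>
      if Nonempty (X i ≃ₗ[A] S) then LinearMap.proj i else 0, fun x i => ?_⟩
    rw [LinearMap.pi_apply]
    split_ifs <;> rfl
  have hsingle : ∀ i x, f₀ (Pi.single i x) =
      if Nonempty (X i ≃ₗ[A] S) then Pi.single i x else 0 := by
    intro i x
    ext l
    rw [hf₀]
    by_cases hl : l = i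
    · subst hl; split_ifs <;> simp
    · split_ifs <;> simp [Pi.single_eq_of_ne hl]
  -- By Schur's lemma each component `X i → X j` of `g` is zero or an isomorphism, so `f₀` is
  -- central in the endomorphism ring and the density theorem applies to it.
  have hcomm : ∀ (g : Module.End A (∀ i, X i)) (x : ∀ i, X i), f₀ (g x) = g (f₀ x) := by
    intro g x
    have hx : x = ∑ i, Pi.single i (x i) := (Finset.univ_sum_single x).symm
    rw [hx]
    simp only [map_sum]
    refine Finset.sum_congr rfl fun i _ => ?_
    ext j
    rw [hf₀, hsingle]
    rcases ((LinearMap.proj j : (∀ i, X i) →ₗ[A] X j) ∘ₗ g ∘ₗ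
      LinearMap.single A X i).bijective_or_eq_zero with hb | hz
    · have e := LinearEquiv.ofBijective _ hb
      have hiff : Nonempty (X j ≃ₗ[A] S) ↔ Nonempty (X i ≃ₗ[A] S) :=
        ⟨fun ⟨h⟩ => ⟨e.trans h⟩, fun ⟨h⟩ => ⟨e.symm.trans h⟩⟩
      simp only [hiff]
      split_ifs <;> simp
    · have h0 : g (Pi.single i (x i)) j = 0 := LinearMap.congr_fun hz (x i)
      rw [h0]
      split_ifs <;> simp [h0]
  let f : Module.End (Module.End A (∀ i, X i)) (∀ i, X i) :=
    { toFun := f₀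
      map_add' := map_add f₀
      map_smul' := fun g x => hcomm g x }
  have hfd : FiniteDimensional E (∀ i, X i) := inferInstance
  obtain ⟨s, hs⟩ := hfd.fg_top
  -- Density only gives agreement on the finite set `s`; as `s` spans over `E`, whose scalars
  -- commute with `a`, agreement holds everywhere.
  obtain ⟨a, ha⟩ := jacobson_density f s
  have hall : ∀ x : ∀ i, X i, f₀ x = a • x := by
    intro x
    have hx : x ∈ Submodule.span E (s : Set (∀ i, X i)) := hs ▸ trivial
    induction hx using Submodule.span_induction with
    | mem x hx => exact ha x hx
    | zero => simp
    | add x y _ _ hx hy => rw [map_add, hx, hy, smul_add]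
    | smul c x _ hx =>
      rw [← algebraMap_smul A c x, map_smul, hx, smul_smul, smul_smul, Algebra.commutes]
  refine ⟨a, fun i => ⟨fun h x => ?_, fun h x => ?_⟩⟩
  · have := congrFun (hall (Pi.single i x)) i
    rw [hf₀, if_pos h, Pi.smul_apply, Pi.single_eq_same] at this
    exact this.symm
  · have := congrFun (hall (Pi.single i x)) i
    rw [hf₀, if_neg h, Pi.smul_apply, Pi.single_eq_same] at this
    exact this.symm

/-- Evaluated at an element of `A` acting as the projection onto one isomorphism class, the relation
becomes the sum of the `c i` over that class times a common dimension, which is nonzero in `E` by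
characteristic zero. -/
theorem sum_eq_zero_of_moduleTrace [CharZero E] {ι : Type*} [Fintype ι] (X : ι → Type*)
    [∀ i, AddCommGroup (X i)] [∀ i, Module A (X i)] [∀ i, Module E (X i)]
    [∀ i, IsScalarTower E A (X i)] [∀ i, IsSimpleModule A (X i)]
    [∀ i, FiniteDimensional E (X i)] (c : ι → E)
    (hc : ∀ a : A, ∑ i, c i * moduleTrace E (X i) a = 0) (i₀ : ι)
    [DecidablePred fun i => Nonempty (X i ≃ₗ[A] X i₀)] :
    ∑ i with Nonempty (X i ≃ₗ[A] X i₀), c i = 0 := by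
  obtain ⟨a, ha⟩ := exists_smul_eq_ite (E := E) (A := A) X (X i₀)
  have hd : (Module.finrank E (X i₀) : E) ≠ 0 := by
    have : Nontrivial (X i₀) := IsSimpleModule.nontrivial A _
    exact Nat.cast_ne_zero.mpr Module.finrank_pos.ne'
  refine (mul_eq_zero.mp ?_).resolve_right hd
  rw [Finset.sum_filter, Finset.sum_mul]
  refine Eq.trans ?_ (hc a)
  refine Finset.sum_congr rfl fun i _ => ?_
  split_ifs with h
  · obtain ⟨e⟩ := id h
    have h2 : Algebra.lsmul E E (X i) a = 1 := by
      ext x; exact (ha i).1 h x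
    rw [moduleTrace, h2, LinearMap.trace_one, (e.restrictScalars E).finrank_eq]
  · have h2 : Algebra.lsmul E E (X i) a = 0 := by
      ext x; exact (ha i).2 h x
    rw [moduleTrace, h2, map_zero, zero_mul, mul_zero]

/-- Coefficients `1` on the `X i` and `-1` on the `Y j` show that each isomorphism class occurs
equally often in both families; bijections between the fibres over the classes are then glued. -/
theorem exists_equiv_of_moduleTrace_eq [CharZero E] {ι κ : Type*} [Fintype ι] [Fintype κ]
    {X : ι → Type v} {Y : κ → Type v}
    [∀ i, AddCommGroup (X i)] [∀ i, Module A (X i)] [∀ i, Module E (X i)]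
    [∀ i, IsScalarTower E A (X i)] [∀ i, IsSimpleModule A (X i)]
    [∀ i, FiniteDimensional E (X i)]
    [∀ i, AddCommGroup (Y i)] [∀ i, Module A (Y i)] [∀ i, Module E (Y i)]
    [∀ i, IsScalarTower E A (Y i)] [∀ i, IsSimpleModule A (Y i)]
    [∀ i, FiniteDimensional E (Y i)]
    (h : ∀ a : A, ∑ i, moduleTrace E (X i) a = ∑ j, moduleTrace E (Y j) a) :
    ∃ e : ι ≃ κ, ∀ i, Nonempty (X i ≃ₗ[A] Y (e i)) := by
  classical
  let Z : ι ⊕ κ → Type v := Sum.elim X Y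
  let iG : ∀ z, AddCommGroup (Z z) := Sum.rec (fun i => (inferInstance : AddCommGroup (X i)))
    (fun j => (inferInstance : AddCommGroup (Y j)))
  let iA : ∀ z, Module A (Z z) := Sum.rec (fun i => (inferInstance : Module A (X i)))
    (fun j => (inferInstance : Module A (Y j)))
  let iE : ∀ z, Module E (Z z) := Sum.rec (fun i => (inferInstance : Module E (X i)))
    (fun j => (inferInstance : Module E (Y j)))
  have iT : ∀ z, IsScalarTower E A (Z z) := Sum.rec (fun i => (inferInstance : IsScalarTower E A (X i)))
    (fun j => (inferInstance : IsScalarTower E A (Y j)))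
  have iS : ∀ z, IsSimpleModule A (Z z) := Sum.rec (fun i => (inferInstance : IsSimpleModule A (X i)))
    (fun j => (inferInstance : IsSimpleModule A (Y j)))
  have iF : ∀ z, FiniteDimensional E (Z z) :=
    Sum.rec (fun i => (inferInstance : FiniteDimensional E (X i)))
      (fun j => (inferInstance : FiniteDimensional E (Y j)))
  let c : ι ⊕ κ → E := Sum.elim 1 (-1)
  have hc : ∀ a : A, ∑ i, c i * moduleTrace E (Z i) a = 0 := by
    intro a
    have h1 : ∀ i, moduleTrace E (Z (Sum.inl i)) a = moduleTrace E (X i) a := fun i => rfl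
    have h2 : ∀ i, moduleTrace E (Z (Sum.inr i)) a = moduleTrace E (Y i) a := fun i => rfl
    rw [Fintype.sum_sum_type]
    simp only [c, Sum.elim_inl, Sum.elim_inr, Pi.one_apply, Pi.neg_apply, one_mul, neg_mul,
      Finset.sum_neg_distrib, ← sub_eq_add_neg, sub_eq_zero, h1, h2]
    exact h a
  let R : Setoid (ι ⊕ κ) :=
    { r := fun i j => Nonempty (Z i ≃ₗ[A] Z j)
      iseqv := ⟨fun _ => ⟨LinearEquiv.refl A _⟩, fun ⟨e⟩ => ⟨e.symm⟩,
        fun ⟨e⟩ ⟨e'⟩ => ⟨e.trans e'⟩⟩ }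
  let f : ι → Quotient R := fun i => ⟦Sum.inl i⟧
  let g : κ → Quotient R := fun i => ⟦Sum.inr i⟧
  have hcard : ∀ q, Nonempty ({i // f i = q} ≃ {j // g j = q}) := by
    intro q
    induction q using Quotient.inductionOn with
    | h i₀ =>
      have h1 := @sum_eq_zero_of_moduleTrace E A _ _ _ _ _ _ Z iG iA iE iT iS iF c hc i₀ _
      rw [Finset.sum_filter, Fintype.sum_sum_type] at h1
      simp only [c, Sum.elim_inl, Sum.elim_inr, Pi.one_apply, Pi.neg_apply] at h1
      rw [← Finset.sum_filter, ← Finset.sum_filter, Finset.sum_neg_distrib, Finset.sum_const,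
        Finset.sum_const, nsmul_one, nsmul_one, ← sub_eq_add_neg, sub_eq_zero, Nat.cast_inj] at h1
      refine ⟨Fintype.equivOfCardEq ?_⟩
      rw [Fintype.card_subtype, Fintype.card_subtype]
      simp only [f, g, Quotient.eq]
      exact h1
  let e := Equiv.ofFiberEquiv fun q => (hcard q).some
  refine ⟨e, fun i => ?_⟩
  have h2 : g (e i) = f i := Equiv.ofFiberEquiv_map _ i
  exact Quotient.eq.mp h2.symm

theorem nonempty_piEquiv {ι κ : Type*} {X : ι → Type*} {Y : κ → Type*}
    [∀ i, AddCommGroup (X i)] [∀ i, Module A (X i)]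
    [∀ i, AddCommGroup (Y i)] [∀ i, Module A (Y i)] (e : ι ≃ κ)
    (he : ∀ i, Nonempty (X i ≃ₗ[A] Y (e i))) : Nonempty ((∀ i, X i) ≃ₗ[A] ∀ j, Y j) :=
  ⟨(LinearEquiv.piCongrRight fun i => (he i).some).trans (LinearEquiv.piCongrLeft A Y e)⟩

end Trace

theorem isoSemisimplifications_of_moduleTrace_eq {E : Type*} [Field E] [CharZero E]
    {A : Type u} [Ring A] [Algebra E A] {V : Type v} [AddCommGroup V] [Module A V] [Module E V]
    [IsScalarTower E A V] [FiniteDimensional E V] {W : Type v} [AddCommGroup W] [Module A W]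
    [Module E W] [IsScalarTower E A W] [FiniteDimensional E W]
    (h : ∀ a : A, moduleTrace E V a = moduleTrace E W a) : IsoSemisimplifications A V W := by
  have : IsNoetherian A V := isNoetherian_of_tower E inferInstance
  have : IsArtinian A V := isArtinian_of_tower E inferInstance
  have : IsNoetherian A W := isNoetherian_of_tower E inferInstance
  have : IsArtinian A W := isArtinian_of_tower E inferInstance
  obtain ⟨s, hs0, hs1⟩ := exists_compositionSeries_of_isNoetherian_isArtinian A V
  obtain ⟨t, ht0, ht1⟩ := exists_compositionSeries_of_isNoetherian_isArtinian A W
  have hs : ∀ i : Fin s.length, IsSimpleModule A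
      ((s i.succ : Submodule A V) ⧸ (s i.castSucc).submoduleOf (s i.succ)) :=
    fun i => (covBy_iff_quot_is_simple (s.step i).le).mp (s.step i)
  have ht : ∀ i : Fin t.length, IsSimpleModule A
      ((t i.succ : Submodule A W) ⧸ (t i.castSucc).submoduleOf (t i.succ)) :=
    fun i => (covBy_iff_quot_is_simple (t.step i).le).mp (t.step i)
  have hfs : ∀ i : Fin s.length, FiniteDimensional E
      ((s i.succ : Submodule A V) ⧸ (s i.castSucc).submoduleOf (s i.succ)) :=
    fun i => finiteDimensional_subquotient _ _
  have hft : ∀ i : Fin t.length, FiniteDimensional E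
      ((t i.succ : Submodule A W) ⧸ (t i.castSucc).submoduleOf (t i.succ)) :=
    fun i => finiteDimensional_subquotient _ _
  obtain ⟨e, he⟩ := exists_equiv_of_moduleTrace_eq (E := E) (A := A)
    (X := fun i : Fin s.length =>
      (s i.succ : Submodule A V) ⧸ (s i.castSucc).submoduleOf (s i.succ))
    (Y := fun i : Fin t.length =>
      (t i.succ : Submodule A W) ⧸ (t i.castSucc).submoduleOf (t i.succ))
    (fun a => (moduleTrace_compositionSeries s hs0 hs1 a).symm.trans
      ((h a).trans (moduleTrace_compositionSeries t ht0 ht1 a)))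
  exact ⟨s, t, hs0, hs1, ht0, ht1, nonempty_piEquiv e he⟩

/-! ### Valuation rings in algebraic extensions -/

section ValuationLift

variable {F L : Type*} [Field F] [Field L] [Algebra F L]

/-- The trace on `F` of a valuation ring of `L`, as a subring. -/
abbrev baseSubring (F : Type*) {L : Type*} [Field F] [Field L] [Algebra F L]
    (V : ValuationSubring L) : Subring F :=
  V.toSubring.comap (algebraMap F L)

theorem mem_of_isIntegral_baseSubring {V W : ValuationSubring L}
    (hW : V.comap (algebraMap F L) ≤ W.comap (algebraMap F L)) {x : L}
    (hx : IsIntegral (baseSubring F V) x) : x ∈ W := by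
  have h1 : IsIntegral W x := by
    obtain ⟨p, hp, hpx⟩ := hx
    let f : baseSubring F V →+* W :=
      { toFun := fun a => ⟨algebraMap F L a, hW a.2⟩
        map_one' := by ext; simp
        map_mul' := fun a b => by ext; simp
        map_zero' := by ext; simp
        map_add' := fun a b => by ext; simp }
    refine ⟨p.map f, hp.map f, ?_⟩
    rw [Polynomial.eval₂_map]
    exact hpx
  obtain ⟨y, hy⟩ := IsIntegrallyClosed.isIntegral_iff.mp h1
  exact hy ▸ y.2

/-- The integral closure of a subring of a field is the intersection of the valuation rings
containing it. -/
theorem isIntegral_baseSubring_iff (V : ValuationSubring L) (x : L) :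
    IsIntegral (baseSubring F V) x ↔ ∀ W : ValuationSubring L,
      V.comap (algebraMap F L) ≤ W.comap (algebraMap F L) → x ∈ W := by
  refine ⟨fun hx W hW => mem_of_isIntegral_baseSubring hW hx, fun h => ?_⟩
  have h1 : x ∈ (⨅ W : {W : ValuationSubring L //
      ((baseSubring F V).map (algebraMap F L) : Set L) ⊆ W.toSubring}, W.1.toSubring) := by
    rw [Subring.mem_iInf]
    exact fun W => h W.1 fun a ha => W.2 ⟨a, ha, rfl⟩
  rw [iInf_valuationSubring_superset, Subring.closure_eq] at h1
  obtain ⟨p, hp, hpx⟩ : IsIntegral ((baseSubring F V).map (algebraMap F L)) x := h1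
  let e : baseSubring F V ≃+* (baseSubring F V).map (algebraMap F L) :=
    Subring.equivMapOfInjective _ _ (algebraMap F L).injective
  refine ⟨p.map (e.symm : _ →+* baseSubring F V), hp.map _, ?_⟩
  rw [Polynomial.eval₂_map, ← hpx]
  congr 1
  ext y
  obtain ⟨z, rfl⟩ := e.surjective y
  simp only [RingHom.comp_apply, RingHom.coe_coe, RingEquiv.symm_apply_apply]
  rfl

/-- Every element of a valuation ring of an algebraic extension is a quotient of integral elements,
with a denominator congruent to one. -/
theorem exists_isIntegral_mul_eq [Algebra.IsAlgebraic F L] (V : ValuationSubring L) {x : L}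
    (hx : x ∈ V) : ∃ y : L, IsIntegral (baseSubring F V) y ∧ IsIntegral (baseSubring F V) (y * x) ∧
      y - 1 ∈ V.nonunits := by
  obtain ⟨p, hp0, hpx⟩ := Algebra.IsAlgebraic.isAlgebraic (R := F) x
  set v : F → V.ValueGroup := fun a => V.valuation (algebraMap F L a) with hv
  have hne : p.support.Nonempty := Polynomial.support_nonempty.mpr hp0
  -- The lexicographic order selects the last coefficient of maximal valuation. After division by
  -- it, all coefficients are integral, and those of index above `j` lie in the maximal ideal.
  obtain ⟨j, hj, hmax⟩ := p.support.exists_max_image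
    (fun i => toLex (v (p.coeff i), i)) hne
  have hcj : p.coeff j ≠ 0 := Polynomial.mem_support_iff.mp hj
  have hcj' : algebraMap F L (p.coeff j) ≠ 0 := by simpa using hcj
  have hvj : 0 < v (p.coeff j) := by
    rw [zero_lt_iff]; exact (Valuation.ne_zero_iff _).mpr hcj'
  set a : ℕ → F := fun i => p.coeff i / p.coeff j with ha
  have hva : ∀ i, v (a i) = v (p.coeff i) / v (p.coeff j) := fun i => by simp [hv, ha]
  have hle : ∀ i, v (a i) ≤ 1 := by
    intro i
    rw [hva, div_le_one₀ hvj]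
    by_cases hi : i ∈ p.support
    · have := hmax i hi
      rw [Prod.Lex.toLex_le_toLex] at this
      exact this.elim le_of_lt fun h => h.1.le
    · rw [Polynomial.notMem_support_iff.mp hi]
      simp [hv]
  have hlt : ∀ i, j < i → v (a i) < 1 := by
    intro i hij
    rw [hva, div_lt_one₀ hvj]
    by_cases hi : i ∈ p.support
    · have := hmax i hi
      rw [Prod.Lex.toLex_le_toLex] at this
      exact this.resolve_right fun h => absurd h.2 (not_le.mpr hij)
    · rw [Polynomial.notMem_support_iff.mp hi]
      simpa [hv] using hvj
  have haj : a j = 1 := div_self hcj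
  have hmem : ∀ i (W : ValuationSubring L), V.comap (algebraMap F L) ≤ W.comap (algebraMap F L) →
      algebraMap F L (a i) ∈ W := fun i W hW =>
    hW (show a i ∈ V.comap (algebraMap F L) from (V.valuation_le_one_iff _).mp (hle i))
  set n := p.natDegree with hn
  have hjn : j ≤ n := Polynomial.le_natDegree_of_mem_supp j hj
  -- The relation for `x` is cut at index `j`: `y` is a polynomial in `x`, while `y * x` is, up to
  -- sign, one in `x⁻¹` (`hyx`). A valuation ring contains `x` or `x⁻¹`, and either way it contains
  -- both `y` and `y * x`.
  set y : L := ∑ i ∈ Finset.Icc j n, algebraMap F L (a i) * x ^ (i - j) with hy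
  have hrel : ∑ i ∈ Finset.range (n + 1), algebraMap F L (a i) * x ^ i = 0 := by
    have h1 := hpx
    rw [Polynomial.aeval_eq_sum_range] at h1
    have h2 : ∑ i ∈ Finset.range (n + 1), algebraMap F L (a i) * x ^ i =
        (algebraMap F L (p.coeff j))⁻¹ * ∑ i ∈ Finset.range (n + 1), p.coeff i • x ^ i := by
      rw [Finset.mul_sum]
      refine Finset.sum_congr rfl fun i _ => ?_
      rw [Algebra.smul_def, ha, map_div₀]
      ring
    rw [h2, h1, mul_zero]
  have hyx : x ≠ 0 → y * x = -∑ i ∈ Finset.range j, algebraMap F L (a i) * x⁻¹ ^ (j - 1 - i) := by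
    intro hx0
    rw [Finset.range_eq_Ico, ← Finset.sum_Ico_consecutive _ (Nat.zero_le j) (by omega : j ≤ n + 1)]
      at hrel
    rw [eq_neg_iff_add_eq_zero, hy, Finset.sum_mul]
    have h1 : ∑ i ∈ Finset.Icc j n, algebraMap F L (a i) * x ^ (i - j) * x =
        (x ^ j)⁻¹ * x * ∑ i ∈ Finset.Ico j (n + 1), algebraMap F L (a i) * x ^ i := by
      rw [Finset.mul_sum]
      refine Finset.sum_congr (by ext; simp) fun i hi => ?_
      have : x ^ i = x ^ (i - j) * x ^ j := by
        rw [← pow_add, Nat.sub_add_cancel (Finset.mem_Ico.mp hi).1]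
      rw [this]
      field_simp
    have h2 : ∑ i ∈ Finset.range j, algebraMap F L (a i) * x⁻¹ ^ (j - 1 - i) =
        (x ^ j)⁻¹ * x * ∑ i ∈ Finset.Ico 0 j, algebraMap F L (a i) * x ^ i := by
      rw [Finset.mul_sum, Finset.range_eq_Ico]
      refine Finset.sum_congr rfl fun i hi => ?_
      have : x ^ j = x ^ (j - 1 - i) * x ^ i * x := by
        rw [← pow_add, ← pow_succ]
        congr 1
        have := (Finset.mem_Ico.mp hi).2
        omega
      rw [this, inv_pow]
      field_simp
    rw [h1, h2, ← mul_add, add_comm, hrel, mul_zero]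
  have key : ∀ W : ValuationSubring L, V.comap (algebraMap F L) ≤ W.comap (algebraMap F L) →
      y ∈ W ∧ y * x ∈ W := by
    intro W hW
    by_cases hxW : x ∈ W
    · have : y ∈ W := sum_mem fun i _ => mul_mem (hmem i W hW) (pow_mem hxW _)
      exact ⟨this, mul_mem this hxW⟩
    · have hx0 : x ≠ 0 := fun h => hxW (h ▸ W.zero_mem)
      have hxi : x⁻¹ ∈ W := (W.mem_or_inv_mem x).resolve_left hxW
      have : y * x ∈ W := by
        rw [hyx hx0]
        exact neg_mem (sum_mem fun i _ => mul_mem (hmem i W hW) (pow_mem hxi _))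
      refine ⟨?_, this⟩
      have h2 := mul_mem this hxi
      rwa [mul_inv_cancel_right₀ hx0] at h2
  refine ⟨y, (isIntegral_baseSubring_iff V y).mpr fun W hW => (key W hW).1,
    (isIntegral_baseSubring_iff V _).mpr fun W hW => (key W hW).2, ?_⟩
  have h1 : y - 1 = ∑ i ∈ Finset.Ioc j n, algebraMap F L (a i) * x ^ (i - j) := by
    rw [hy, ← Finset.add_sum_Ioc_eq_sum_Icc hjn, haj]
    simp
  rw [h1, ValuationSubring.mem_nonunits_iff]
  refine Valuation.map_sum_lt _ one_ne_zero fun i hi => ?_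
  rw [map_mul]
  calc _ ≤ V.valuation (algebraMap F L (a i)) * 1 := by
        gcongr
        rw [map_pow]
        exact pow_le_one' ((V.valuation_le_one_iff x).mpr hx) _
    _ < 1 := by
        rw [mul_one]; exact hlt i (Finset.mem_Ioc.mp hi).1

theorem sub_mem_nonunits_iff (V : ValuationSubring L) (x y : V) :
    (x : L) - y ∈ V.nonunits ↔ IsLocalRing.residue V x = IsLocalRing.residue V y := by
  rw [← sub_eq_zero, ← map_sub, IsLocalRing.residue_eq_zero_iff, ← V.coe_mem_nonunits_iff]
  rfl

theorem smul_mem_of_smul_eq {G : Type*} [Group G] [MulSemiringAction G L] {V W : ValuationSubring L}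
    {g : G} (h : g • V = W) {x : L} (hx : x ∈ V) : g • x ∈ W :=
  h ▸ ValuationSubring.smul_mem_pointwise_smul _ _ _ hx

theorem smul_mem_nonunits_of_smul_eq {G : Type*} [Group G] [MulSemiringAction G L]
    {V W : ValuationSubring L} {g : G} (h : g • V = W) {x : L} (hx : x ∈ V.nonunits) :
    g • x ∈ W.nonunits := by
  rw [ValuationSubring.mem_nonunits_iff_or] at hx ⊢
  refine hx.imp (fun h => by rw [h, smul_zero]) fun hn h3 => hn ?_
  rw [← h, ← smul_inv''] at h3
  exact ValuationSubring.smul_mem_pointwise_smul_iff.mp h3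

/-- The integral closure surjects onto the residue field of `V`: as `y ≡ 1`, the integral element `y
* x` has the residue of `x`. -/
theorem exists_isIntegral_sub_mem_nonunits [Algebra.IsAlgebraic F L] (V : ValuationSubring L)
    {x : L} (hx : x ∈ V) : ∃ b : L, IsIntegral (baseSubring F V) b ∧ x - b ∈ V.nonunits := by
  obtain ⟨y, -, hyx, hy⟩ := exists_isIntegral_mul_eq (F := F) V hx
  refine ⟨y * x, hyx, ?_⟩
  have : x - y * x = -(y - 1) * x := by ring
  rw [this, V.mem_nonunits_iff, map_mul, Valuation.map_neg]
  exact mul_lt_one_of_lt_of_le (V.mem_nonunits_iff.mp hy) ((V.valuation_le_one_iff x).mpr hx)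

/-- The integral closure of the base subring, included in a valuation ring. -/
def integralClosureInclusion (V W : ValuationSubring L)
    (h : V.comap (algebraMap F L) = W.comap (algebraMap F L)) :
    integralClosure (baseSubring F V) L →+* W where
  toFun b := ⟨b, mem_of_isIntegral_baseSubring h.le b.2⟩
  map_one' := rfl
  map_mul' _ _ := rfl
  map_zero' := rfl
  map_add' _ _ := rfl

/-- The prime of the integral closure of the base subring below a valuation ring. -/
def integralClosurePrime (V W : ValuationSubring L)
    (h : V.comap (algebraMap F L) = W.comap (algebraMap F L)) :
    Ideal (integralClosure (baseSubring F V) L) :=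
  (IsLocalRing.maximalIdeal W).comap (integralClosureInclusion V W h)

instance (V W : ValuationSubring L) (h : V.comap (algebraMap F L) = W.comap (algebraMap F L)) :
    (integralClosurePrime V W h).IsPrime :=
  inferInstanceAs ((IsLocalRing.maximalIdeal W).comap _).IsPrime

theorem mem_integralClosurePrime {V W : ValuationSubring L}
    {h : V.comap (algebraMap F L) = W.comap (algebraMap F L)}
    {b : integralClosure (baseSubring F V) L} :
    b ∈ integralClosurePrime V W h ↔ (b : L) ∈ W.nonunits :=
  W.coe_mem_nonunits_iff.symm

instance [IsGalois F L] (V : ValuationSubring L) :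
    Algebra.IsInvariant (baseSubring F V) (integralClosure (baseSubring F V) L) Gal(L/F) where
  isInvariant b hb := by
    obtain ⟨a, ha⟩ := (InfiniteGalois.mem_range_algebraMap_iff_fixed (k := F) (b : L)).mpr
      fun g => congrArg Subtype.val (hb g)
    refine ⟨⟨a, ?_⟩, Subtype.ext ha⟩
    change algebraMap F L a ∈ V
    rw [ha]
    exact mem_of_isIntegral_baseSubring le_rfl b.2

theorem continuousSMul_integralClosure [IsGalois F L] (V : ValuationSubring L)
    [TopologicalSpace (integralClosure (baseSubring F V) L)]
    [DiscreteTopology (integralClosure (baseSubring F V) L)] :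
    ContinuousSMul Gal(L/F) (integralClosure (baseSubring F V) L) := by
  rw [continuousSMul_iff_stabilizer_isOpen]
  intro x
  convert stabilizer_isOpen_of_isIntegral (K := F) (x : L) using 2
  ext g
  simp [MulAction.mem_stabilizer_iff, Subtype.ext_iff]

/-- A valuation ring is recovered from its prime in the integral closure by localization: `x = (y *
x) / y` with `y` outside the prime. Thus statements about primes in profinite invariant theory
become statements about valuation rings. -/
theorem smul_le_of_smul_integralClosurePrime [Algebra.IsAlgebraic F L] {V W W' : ValuationSubring L}
    {h : V.comap (algebraMap F L) = W.comap (algebraMap F L)}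
    {h' : V.comap (algebraMap F L) = W'.comap (algebraMap F L)} {g : Gal(L/F)}
    (hg : integralClosurePrime V W' h' = g • integralClosurePrime V W h) : g • W ≤ W' := by
  intro x hx
  obtain ⟨x, hxW, rfl⟩ := (ValuationSubring.mem_smul_pointwise_iff_exists _ _ _).mp hx
  obtain ⟨y, hy, hyx, hy1⟩ := exists_isIntegral_mul_eq (F := F) W hxW
  have hb : baseSubring F V = baseSubring F W := by
    ext a; exact SetLike.ext_iff.mp h a
  rw [← hb] at hy hyx
  have hyW : y ∉ W.nonunits := by
    intro h0
    have h1 : (1 : L) = y - (y - 1) := by ring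
    have h2 : W.valuation 1 < 1 := by
      rw [h1]
      exact Valuation.map_sub_lt _ (W.mem_nonunits_iff.mp h0) (W.mem_nonunits_iff.mp hy1)
    simp at h2
  have hgy : g • y ∉ W'.nonunits := by
    intro h0
    have h1 : g • (⟨y, hy⟩ : integralClosure (baseSubring F V) L) ∈ integralClosurePrime V W' h' :=
      mem_integralClosurePrime.mpr h0
    rw [hg, Ideal.smul_mem_pointwise_smul_iff] at h1
    exact hyW (mem_integralClosurePrime.mp h1)
  have hgyx : g • y * g • x ∈ W' := by
    rw [← smul_mul']
    exact mem_of_isIntegral_baseSubring h'.le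
      (g • (⟨y * x, hyx⟩ : integralClosure (baseSubring F V) L)).2
  rw [W'.mem_nonunits_iff_or, not_or, not_not] at hgy
  have h3 := mul_mem hgy.2 hgyx
  rwa [inv_mul_cancel_left₀ hgy.1] at h3

theorem smul_eq_of_smul_integralClosurePrime [Algebra.IsAlgebraic F L] {V W W' : ValuationSubring L}
    {h : V.comap (algebraMap F L) = W.comap (algebraMap F L)}
    {h' : V.comap (algebraMap F L) = W'.comap (algebraMap F L)} {g : Gal(L/F)}
    (hg : integralClosurePrime V W' h' = g • integralClosurePrime V W h) : g • W = W' := by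
  refine le_antisymm (smul_le_of_smul_integralClosurePrime hg) ?_
  have h1 : g⁻¹ • W' ≤ W :=
    smul_le_of_smul_integralClosurePrime (h := h') (h' := h) (by rw [hg, inv_smul_smul])
  rwa [ValuationSubring.pointwise_smul_subset_iff, inv_inv] at h1

/-- The Galois group acts transitively on the valuation rings above a given one. -/
theorem exists_smul_eq_of_comap_eq [IsGalois F L] {V W : ValuationSubring L}
    (h : V.comap (algebraMap F L) = W.comap (algebraMap F L)) : ∃ g : Gal(L/F), g • V = W := by
  let _ : TopologicalSpace (integralClosure (baseSubring F V) L) := ⊥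
  have : DiscreteTopology (integralClosure (baseSubring F V) L) := ⟨rfl⟩
  have := continuousSMul_integralClosure (F := F) V
  obtain ⟨g, hg⟩ := Algebra.IsInvariant.exists_smul_of_under_eq_of_profinite
    (A := baseSubring F V) (G := Gal(L/F)) (integralClosurePrime V V rfl)
    (integralClosurePrime V W h) (by
      ext a
      have h1 : ∀ (W : ValuationSubring L) (h : V.comap (algebraMap F L) =
          W.comap (algebraMap F L)), a ∈ (integralClosurePrime V W h).under (baseSubring F V) ↔
            (a : F) ∈ (W.comap (algebraMap F L)).nonunits := by
        intro W h
        rw [Ideal.mem_comap, mem_integralClosurePrime, ValuationSubring.mem_nonunits_iff_or,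
          ValuationSubring.mem_nonunits_iff_or, ValuationSubring.mem_comap, map_inv₀,
          ← map_eq_zero (algebraMap F L) (a := (a : F))]
        rfl
      rw [h1, h1, h])
  exact ⟨g, smul_eq_of_smul_integralClosurePrime hg⟩

/-- The stabilizer of a valuation ring surjects onto the automorphisms of its residue field
that are trivial on the residue field of the base. -/
theorem exists_smul_eq_and_residue_eq [IsGalois F L] (V : ValuationSubring L)
    (φ : IsLocalRing.ResidueField V ≃+* IsLocalRing.ResidueField V)
    (hφ : ∀ (a : F) (ha : algebraMap F L a ∈ V),
      φ (IsLocalRing.residue V ⟨_, ha⟩) = IsLocalRing.residue V ⟨_, ha⟩) :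
    ∃ g : Gal(L/F), g • V = V ∧ ∀ (x : V) (hx : g x ∈ V),
      IsLocalRing.residue V ⟨g x, hx⟩ = φ (IsLocalRing.residue V x) := by
  let _ : TopologicalSpace (integralClosure (baseSubring F V) L) := ⊥
  have : DiscreteTopology (integralClosure (baseSubring F V) L) := ⟨rfl⟩
  have := continuousSMul_integralClosure (F := F) V
  set Q := integralClosurePrime (F := F) V V rfl with hQ
  set P := Q.under (baseSubring F V) with hP
  set r : integralClosure (baseSubring F V) L →+* IsLocalRing.ResidueField V :=
    (IsLocalRing.residue V).comp (integralClosureInclusion V V rfl) with hr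
  have hker : RingHom.ker r = Q := by
    ext b
    rw [RingHom.mem_ker, hr, RingHom.comp_apply, IsLocalRing.residue_eq_zero_iff]
    rfl
  have hsurj : Function.Surjective r := by
    intro x
    obtain ⟨x, rfl⟩ := IsLocalRing.residue_surjective x
    obtain ⟨b, hb, hxb⟩ := exists_isIntegral_sub_mem_nonunits (F := F) V x.2
    exact ⟨⟨b, hb⟩, ((sub_mem_nonunits_iff V x ⟨b, mem_of_isIntegral_baseSubring le_rfl hb⟩).mp
      hxb).symm⟩
  -- The residue field of `V` is the quotient of the integral closure by `Q`, so `φ` becomes an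
  -- automorphism to which the surjectivity of the stabilizer of `Q` applies.
  let e : (integralClosure (baseSubring F V) L ⧸ Q) ≃+* IsLocalRing.ResidueField V :=
    (Ideal.quotEquivOfEq hker.symm).trans (RingHom.quotientKerEquivOfSurjective hsurj)
  have he : ∀ b, e (Ideal.Quotient.mk Q b) = r b := fun b => rfl
  let σ : (integralClosure (baseSubring F V) L ⧸ Q) ≃ₐ[baseSubring F V ⧸ P]
      (integralClosure (baseSubring F V) L ⧸ Q) :=
    AlgEquiv.ofRingEquiv (f := (e.trans φ).trans e.symm) (by
      intro a
      obtain ⟨a, rfl⟩ := Ideal.Quotient.mk_surjective a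
      have h1 : algebraMap (baseSubring F V ⧸ P) (integralClosure (baseSubring F V) L ⧸ Q)
        (Ideal.Quotient.mk P a) = Ideal.Quotient.mk Q (algebraMap _ _ a) := rfl
      rw [h1, RingEquiv.trans_apply, RingEquiv.trans_apply, RingEquiv.symm_apply_eq, he]
      exact hφ a a.2)
  obtain ⟨⟨g, hgQ⟩, hg⟩ :=
    Ideal.Quotient.stabilizerHom_surjective_of_profinite (G := Gal(L/F)) P Q σ
  have hgV : g • V = V := smul_eq_of_smul_integralClosurePrime (h := rfl) (h' := rfl) hgQ.symm
  refine ⟨g, hgV, fun x hx => ?_⟩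
  obtain ⟨b, hb, hxb⟩ := exists_isIntegral_sub_mem_nonunits (F := F) V x.2
  have hbV := mem_of_isIntegral_baseSubring (F := F) (V := V) le_rfl hb
  have hgb : g • b ∈ V := smul_mem_of_smul_eq hgV hbV
  have h1 : g • (x : L) - g • b ∈ V.nonunits := by
    rw [← smul_sub]
    exact smul_mem_nonunits_of_smul_eq hgV hxb
  have h2 := (sub_mem_nonunits_iff V ⟨g x, hx⟩ ⟨_, hgb⟩).mp h1
  rw [h2, (sub_mem_nonunits_iff V x ⟨b, hbV⟩).mp hxb]
  have h3 : Ideal.Quotient.stabilizerHom Q P Gal(L/F) ⟨g, hgQ⟩ (Ideal.Quotient.mk Q ⟨b, hb⟩) =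
    σ (Ideal.Quotient.mk Q ⟨b, hb⟩) := by rw [hg]
  have h4 := congrArg e h3
  have h5 : e (σ (Ideal.Quotient.mk Q ⟨b, hb⟩)) = φ (e (Ideal.Quotient.mk Q ⟨b, hb⟩)) :=
    e.apply_symm_apply _
  rw [h5] at h4
  exact h4

end ValuationLift

/-! ### Lifting inertia and Frobenius elements -/

section PlaceLift

variable {K M L : Type*} [Field K] [Field M] [Field L] [Algebra K M] [Algebra K L] [Algebra M L]
  [IsScalarTower K M L]

namespace Place

theorem mem_inertia_finite_iff {V : ValuationSubring L} {hV : V ≠ ⊤} {σ : L ≃ₐ[K] L} :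
    σ ∈ (finite V hV).inertia K ↔ σ • V = V ∧ ∀ x ∈ V, σ x - x ∈ V.nonunits := by
  have key : ∀ h : σ • V = V, (⟨σ, h⟩ : V.decompositionSubgroup K) ∈ V.inertiaSubgroup K ↔
      ∀ x ∈ V, σ x - x ∈ V.nonunits := by
    intro h
    rw [ValuationSubring.inertiaSubgroup, MonoidHom.mem_ker, RingEquiv.ext_iff]
    refine ⟨fun h1 x hx => ?_, fun h1 x => ?_⟩
    · have h2 := h1 (IsLocalRing.residue V ⟨x, hx⟩)
      exact (sub_mem_nonunits_iff V ⟨σ x, smul_mem_of_smul_eq h hx⟩ ⟨x, hx⟩).mpr h2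
    · obtain ⟨x, rfl⟩ := IsLocalRing.residue_surjective x
      exact (sub_mem_nonunits_iff V ⟨σ x, smul_mem_of_smul_eq h x.2⟩ x).mp (h1 x x.2)
  constructor
  · rintro ⟨⟨σ, h⟩, h1, rfl⟩
    exact ⟨h, (key h).mp h1⟩
  · rintro ⟨h, h1⟩
    exact ⟨⟨σ, h⟩, (key h).mpr h1, rfl⟩

theorem LiesOver.trans {z : Place L} {y : Place M} {x : Place K} (h : z.LiesOver y)
    (h' : y.LiesOver x) : z.LiesOver x := by
  match z, y, x, h, h' with
  | finite C _, finite B _, finite A _, h, h' =>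
    change C.comap (algebraMap K L) = A
    have h1 : C.comap (algebraMap M L) = B := h
    have h2 : B.comap (algebraMap K M) = A := h'
    rw [← h2, ← h1, ValuationSubring.comap_comap, IsScalarTower.algebraMap_eq K M L]
  | infinite c, infinite b, infinite a, h, h' =>
    change c.comap (algebraMap K L) = a
    have h1 : c.comap (algebraMap M L) = b := h
    have h2 : b.comap (algebraMap K M) = a := h'
    rw [← h2, ← h1, ← NumberField.InfinitePlace.comap_comp, IsScalarTower.algebraMap_eq K M L]

theorem LiesOver.exists_between {z : Place L} {x : Place K} (h : z.LiesOver x) :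
    ∃ y : Place M, z.LiesOver y ∧ y.LiesOver x := by
  match z, x, h with
  | finite C _, finite A hA, h =>
    have h1 : (C.comap (algebraMap M L)).comap (algebraMap K M) = A := by
      have h2 : C.comap (algebraMap K L) = A := h
      rw [← h2, ValuationSubring.comap_comap, IsScalarTower.algebraMap_eq K M L]
    refine ⟨finite (C.comap (algebraMap M L)) fun h2 => hA ?_, rfl, h1⟩
    rw [← h1, h2]; rfl
  | infinite c, infinite a, h =>
    have h2 : c.comap (algebraMap K L) = a := h
    refine ⟨infinite (c.comap (algebraMap M L)), rfl, ?_⟩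
    change (c.comap (algebraMap M L)).comap (algebraMap K M) = a
    rw [← h2, ← NumberField.InfinitePlace.comap_comp, IsScalarTower.algebraMap_eq K M L]

end Place

/-- Some valuation ring of `L` dominates `O`. If `a ∉ O` became integral in it, then `a⁻¹ ∈ O` would
become a unit there, hence be a unit of `O` by locality, a contradiction. -/
theorem exists_valuationSubring_comap_eq (O : ValuationSubring M) :
    ∃ V : ValuationSubring L, V.comap (algebraMap M L) = O := by
  obtain ⟨V, hV, hloc⟩ := IsLocalRing.exists_factor_valuationRing
    ((algebraMap M L).comp O.subtype)
  refine ⟨V, le_antisymm (fun a ha => ?_) fun a ha => hV ⟨a, ha⟩⟩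
  by_contra hn
  have ha' : a⁻¹ ∈ O := (O.mem_or_inv_mem a).resolve_left hn
  have ha0 : a ≠ 0 := fun h => hn (h ▸ O.zero_mem)
  have hu : IsUnit (⟨a⁻¹, ha'⟩ : O) := by
    refine hloc.map_nonunit _ (IsUnit.of_mul_eq_one ⟨algebraMap M L a, ha⟩ (Subtype.ext ?_))
    change algebraMap M L a⁻¹ * algebraMap M L a = 1
    rw [← map_mul, inv_mul_cancel₀ ha0, map_one]
  obtain ⟨b, hb⟩ := hu.exists_right_inv
  have h1 : a⁻¹ * (b : M) = 1 := congrArg Subtype.val hb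
  have h2 : (b : M) = a := by
    rw [← mul_one a, ← h1, mul_inv_cancel_left₀ ha0]
  exact hn (h2 ▸ b.2)

/-- An automorphism of `M` that stabilizes a valuation ring lifts to an automorphism of `L` that
stabilizes a given valuation ring above, with a prescribed action on the residue field. -/
theorem exists_lift_smul_eq_and_residue_eq [IsGalois M L] [Normal K L] (V : ValuationSubring L)
    {τ : M ≃ₐ[K] M} (hτ : τ • V.comap (algebraMap M L) = V.comap (algebraMap M L))
    (ψ : IsLocalRing.ResidueField V ≃+* IsLocalRing.ResidueField V)
    (hψ : ∀ (a : M) (ha : algebraMap M L a ∈ V) (ha' : algebraMap M L (τ a) ∈ V),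
      ψ (IsLocalRing.residue V ⟨_, ha⟩) = IsLocalRing.residue V ⟨_, ha'⟩) :
    ∃ σ : L ≃ₐ[K] L, (∀ a, σ (algebraMap M L a) = algebraMap M L (τ a)) ∧ σ • V = V ∧
      ∀ (x : V) (hx : σ x ∈ V), IsLocalRing.residue V ⟨σ x, hx⟩ = ψ (IsLocalRing.residue V x) := by
  set σ₀ : L ≃ₐ[K] L := τ.liftNormal L
  have hσ₀ : ∀ a, σ₀ (algebraMap M L a) = algebraMap M L (τ a) := fun a => τ.liftNormal_commutes L a
  have hτ' : ∀ a, algebraMap M L (τ a) ∈ V ↔ algebraMap M L a ∈ V := by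
    intro a
    change τ • a ∈ V.comap (algebraMap M L) ↔ _
    conv_lhs => rw [← hτ, ValuationSubring.smul_mem_pointwise_smul_iff]
    rfl
  have hcomap : (σ₀ • V).comap (algebraMap M L) = V.comap (algebraMap M L) := by
    ext a
    rw [ValuationSubring.mem_comap, ValuationSubring.mem_pointwise_smul_iff_inv_smul_mem]
    obtain ⟨a, rfl⟩ := τ.surjective a
    rw [← hσ₀, ValuationSubring.mem_comap, hσ₀, hτ', ← hσ₀]
    change σ₀.symm (σ₀ _) ∈ V ↔ _
    rw [σ₀.symm_apply_apply]
  -- An arbitrary lift `σ₀` is corrected twice by elements of `Gal(L/M)`: by `g₁` so that it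
  -- stabilizes `V`, then by `g₂` so that it acts as `ψ` on the residue field.
  obtain ⟨g₁, hg₁⟩ := exists_smul_eq_of_comap_eq hcomap
  set σ₁ : L ≃ₐ[K] L := g₁.restrictScalars K * σ₀ with hσ₁
  have hσ₁V : σ₁ • V = V := by rw [hσ₁, mul_smul]; exact hg₁
  have hσ₁a : ∀ a, σ₁ (algebraMap M L a) = algebraMap M L (τ a) := by
    intro a
    change g₁ (σ₀ _) = _
    rw [hσ₀, g₁.commutes]
  let s : IsLocalRing.ResidueField V ≃+* IsLocalRing.ResidueField V :=
    MulSemiringAction.toRingEquiv (V.decompositionSubgroup K) (IsLocalRing.ResidueField V)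
      ⟨σ₁, hσ₁V⟩
  have hs : ∀ (x : V) (hx : σ₁ x ∈ V), s (IsLocalRing.residue V x) =
      IsLocalRing.residue V ⟨σ₁ x, hx⟩ := fun x hx => rfl
  obtain ⟨g₂, hg₂, hg₂φ⟩ := exists_smul_eq_and_residue_eq (F := M) V (ψ.trans s.symm) (by
    intro a ha
    rw [RingEquiv.trans_apply, RingEquiv.symm_apply_eq, hψ a ha ((hτ' a).mpr ha),
      hs _ (smul_mem_of_smul_eq hσ₁V ha)]
    congr 1
    exact Subtype.ext (hσ₁a a).symm)
  refine ⟨σ₁ * g₂.restrictScalars K, fun a => ?_, ?_, fun x hx => ?_⟩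
  · change σ₁ (g₂ _) = _
    rw [g₂.commutes, hσ₁a]
  · rw [mul_smul]
    change σ₁ • (g₂ • V) = V
    rw [hg₂, hσ₁V]
  · have h1 := hg₂φ x (smul_mem_of_smul_eq hg₂ x.2)
    have h2 := congrArg s h1
    rw [RingEquiv.trans_apply, RingEquiv.apply_symm_apply] at h2
    exact h2

/-- For a valuation ring the prescribed residue action is the identity; for an archimedean place,
transitivity of `Gal(L/M)` on the places above suffices. -/
theorem Place.exists_lift_inertia [IsGalois M L] [Normal K L] {y : Place M} {τ : M ≃ₐ[K] M}
    (hτ : τ ∈ y.inertia K) : ∃ z : Place L, z.LiesOver y ∧ ∃ σ ∈ z.inertia K,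
      ∀ a, σ (algebraMap M L a) = algebraMap M L (τ a) := by
  match y, hτ with
  | finite O hO, hτ =>
    obtain ⟨V, rfl⟩ := exists_valuationSubring_comap_eq (L := L) O
    obtain ⟨h1, h2⟩ := mem_inertia_finite_iff.mp hτ
    obtain ⟨σ, hσ, hσV, hres⟩ := exists_lift_smul_eq_and_residue_eq V h1 (RingEquiv.refl _) (by
      intro a ha ha'
      rw [RingEquiv.refl_apply, eq_comm, ← sub_mem_nonunits_iff]
      have h3 := h2 a ha
      rw [ValuationSubring.mem_nonunits_iff_or] at h3 ⊢
      rw [← map_sub, map_eq_zero, ← map_inv₀]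
      exact h3)
    refine ⟨finite V fun h => hO (by rw [h]; rfl), rfl, σ, ?_, hσ⟩
    refine mem_inertia_finite_iff.mpr ⟨hσV, fun x hx => ?_⟩
    exact (sub_mem_nonunits_iff V ⟨σ x, smul_mem_of_smul_eq hσV hx⟩ ⟨x, hx⟩).mpr (hres ⟨x, hx⟩ _)
  | infinite b, hτ =>
    obtain ⟨c, rfl⟩ := NumberField.InfinitePlace.comap_surjective (K := L) b
    set σ₀ : L ≃ₐ[K] L := τ.liftNormal L
    have hσ₀ : ∀ a, σ₀ (algebraMap M L a) = algebraMap M L (τ a) :=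
      fun a => τ.liftNormal_commutes L a
    have hcomap : (σ₀ • c).comap (algebraMap M L) = c.comap (algebraMap M L) := by
      have h1 : τ • c.comap (algebraMap M L) = c.comap (algebraMap M L) := hτ
      rw [← h1]
      ext a
      obtain ⟨a, rfl⟩ := τ.surjective a
      rw [NumberField.InfinitePlace.comap_apply, ← hσ₀, NumberField.InfinitePlace.smul_apply,
        NumberField.InfinitePlace.smul_apply, NumberField.InfinitePlace.comap_apply,
        AlgEquiv.symm_apply_apply, AlgEquiv.symm_apply_apply]
    obtain ⟨g, hg⟩ := NumberField.InfinitePlace.exists_smul_eq_of_comap_eq hcomap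
    refine ⟨infinite c, rfl, g.restrictScalars K * σ₀, ?_, fun a => ?_⟩
    · change (g.restrictScalars K * σ₀) • c = c
      rw [mul_smul]
      exact hg
    · change g (σ₀ _) = _
      rw [hσ₀, g.commutes]

theorem Place.restrict_mem_inertia {K L M : Type*} [Field K] [Field L] [Field M] [Algebra K L]
    [Algebra K M] [Algebra M L] {z : Place L} {y : Place M} (h : z.LiesOver y) {σ : L ≃ₐ[K] L}
    (hσ : σ ∈ z.inertia K) {τ : M ≃ₐ[K] M}
    (hστ : ∀ a, σ (algebraMap M L a) = algebraMap M L (τ a)) : τ ∈ y.inertia K := by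
  match z, y, h, hσ with
  | finite V _, finite O _, h, hσ =>
    obtain rfl : V.comap (algebraMap M L) = O := h
    obtain ⟨h1, h2⟩ := mem_inertia_finite_iff.mp hσ
    refine mem_inertia_finite_iff.mpr ⟨?_, fun a ha => ?_⟩
    · ext a
      obtain ⟨a, rfl⟩ := τ.surjective a
      change τ • a ∈ _ ↔ _
      rw [ValuationSubring.smul_mem_pointwise_smul_iff, ValuationSubring.mem_comap,
        ValuationSubring.mem_comap, ← hστ]
      conv_rhs => rw [← h1]
      exact ValuationSubring.smul_mem_pointwise_smul_iff.symm
    · have h3 := h2 _ ha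
      rw [hστ] at h3
      rw [ValuationSubring.mem_nonunits_iff_or] at h3 ⊢
      rw [← map_sub, map_eq_zero, ← map_inv₀] at h3
      exact h3
  | infinite c, infinite b, h, hσ =>
    obtain rfl : c.comap (algebraMap M L) = b := h
    have h1 : σ • c = c := hσ
    change τ • c.comap (algebraMap M L) = _
    ext a
    obtain ⟨a, rfl⟩ := τ.surjective a
    conv_rhs => rw [← h1]
    rw [NumberField.InfinitePlace.smul_apply, NumberField.InfinitePlace.comap_apply,
      NumberField.InfinitePlace.comap_apply, ← hστ, NumberField.InfinitePlace.smul_apply,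
      AlgEquiv.symm_apply_apply, AlgEquiv.symm_apply_apply]

/-- The residue field of a valuation ring of an algebraic extension is algebraic over the residue
field of its trace on the base, so that the power map of exponent the cardinality of the latter is
bijective. -/
theorem exists_residueField_frobenius [Algebra.IsAlgebraic K L] (V : ValuationSubring L)
    {A : ValuationSubring K} (hA : V.comap (algebraMap K L) = A)
    [Finite (IsLocalRing.ResidueField A)] :
    ∃ ψ : IsLocalRing.ResidueField V ≃+* IsLocalRing.ResidueField V,
      ∀ x, ψ x = x ^ Nat.card (IsLocalRing.ResidueField A) := by
  subst hA
  set A := V.comap (algebraMap K L)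
  have := Fintype.ofFinite (IsLocalRing.ResidueField A)
  let f : A →+* V :=
    { toFun := fun a => ⟨algebraMap K L a, a.2⟩
      map_one' := by ext; simp
      map_mul' := fun a b => by ext; simp
      map_zero' := by ext; simp
      map_add' := fun a b => by ext; simp }
  have hloc : IsLocalHom f := by
    refine ⟨fun a ha => ?_⟩
    obtain ⟨b, hb⟩ := ha.exists_right_inv
    have h1 : algebraMap K L a * b = 1 := congrArg Subtype.val hb
    have ha0 : (a : K) ≠ 0 := by
      intro h; rw [h, map_zero, zero_mul] at h1; exact zero_ne_one h1
    have h2 : (b : L) = algebraMap K L (a : K)⁻¹ := by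
      rw [map_inv₀]; exact eq_inv_of_mul_eq_one_right h1
    refine IsUnit.of_mul_eq_one ⟨(a : K)⁻¹, ?_⟩ (Subtype.ext (mul_inv_cancel₀ ha0))
    exact show algebraMap K L (a : K)⁻¹ ∈ V from h2 ▸ b.2
  let _ : Algebra (IsLocalRing.ResidueField A) (IsLocalRing.ResidueField V) :=
    (IsLocalRing.ResidueField.map f).toAlgebra
  have halg : Algebra.IsAlgebraic (IsLocalRing.ResidueField A) (IsLocalRing.ResidueField V) := by
    refine ⟨fun x => ?_⟩
    obtain ⟨x, rfl⟩ := IsLocalRing.residue_surjective x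
    obtain ⟨b, hb, hxb⟩ := exists_isIntegral_sub_mem_nonunits (F := K) V x.2
    have hbV := mem_of_isIntegral_baseSubring (F := K) (V := V) le_rfl hb
    rw [(sub_mem_nonunits_iff V x ⟨b, hbV⟩).mp hxb]
    refine IsIntegral.isAlgebraic ?_
    obtain ⟨p, hp, hpb⟩ := hb
    let i : baseSubring K V →+* A := RingHom.id A
    refine ⟨p.map ((IsLocalRing.residue A).comp i), hp.map _, ?_⟩
    rw [Polynomial.eval₂_map]
    have h1 : ((algebraMap (IsLocalRing.ResidueField A) (IsLocalRing.ResidueField V)).comp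
        ((IsLocalRing.residue A).comp i)) = (IsLocalRing.residue V).comp (f.comp i) := by
      ext a; rfl
    rw [h1, ← Polynomial.hom_eval₂, ← map_zero (IsLocalRing.residue V)]
    congr 1
    apply V.subtype_injective
    rw [Polynomial.hom_eval₂, map_zero]
    exact hpb
  refine ⟨(FiniteField.frobeniusAlgEquivOfAlgebraic (IsLocalRing.ResidueField A)
    (IsLocalRing.ResidueField V)).toRingEquiv, fun x => ?_⟩
  rw [Nat.card_eq_fintype_card]
  rfl

theorem Place.exists_lift_isFrobenius [IsGalois M L] [Normal K L] {y : Place M} {t : Place K}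
    {τ : M ≃ₐ[K] M} (hτ : y.IsFrobenius t τ) : ∃ (z : Place L) (σ : L ≃ₐ[K] L),
      z.IsFrobenius t σ ∧ ∀ a, σ (algebraMap M L a) = algebraMap M L (τ a) := by
  match y, t, hτ with
  | finite O hO, finite A hA, ⟨hOA, hτO, hτ⟩ =>
    obtain ⟨V, rfl⟩ := exists_valuationSubring_comap_eq (L := L) O
    have hVA : V.comap (algebraMap K L) = A := by
      rw [← hOA, ValuationSubring.comap_comap, IsScalarTower.algebraMap_eq K M L]
    -- For an infinite residue field `Nat.card` is `0`, and the Frobenius condition at `z = 0` would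
    -- make `-1` a nonunit.
    have hfin : Finite (IsLocalRing.ResidueField A) := by
      by_contra hinf
      rw [not_finite_iff_infinite] at hinf
      have h1 := hτ 0 (zero_mem _)
      rw [Nat.card_eq_zero_of_infinite, pow_zero, map_zero, zero_sub,
        ValuationSubring.mem_nonunits_iff, Valuation.map_neg, map_one] at h1
      exact lt_irrefl _ h1
    obtain ⟨ψ, hψ⟩ := exists_residueField_frobenius V hVA
    obtain ⟨σ, hσ, hσV, hres⟩ := exists_lift_smul_eq_and_residue_eq V hτO ψ (by
      intro a ha ha'
      rw [hψ, ← map_pow, eq_comm, ← sub_mem_nonunits_iff]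
      have h3 := hτ a ha
      rw [ValuationSubring.mem_nonunits_iff_or] at h3 ⊢
      rw [← map_eq_zero (algebraMap M L), ValuationSubring.mem_comap, map_inv₀, map_sub,
        map_pow] at h3
      exact h3)
    refine ⟨finite V fun h => hO (by rw [h]; rfl), σ, ⟨hVA, hσV, fun x hx => ?_⟩, hσ⟩
    refine (sub_mem_nonunits_iff V ⟨σ x, smul_mem_of_smul_eq hσV hx⟩ (⟨x, hx⟩ ^ _)).mpr ?_
    rw [hres ⟨x, hx⟩, hψ, map_pow]

end PlaceLift

/-! ### The tower in terms of subgroups of the absolute Galois group -/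

section TowerGroups

variable {K : Type u} [Field K] {Kb : Type v} [Field Kb] [Algebra K Kb]

/-- Generators of the subgroup of `H` whose fixed field is the maximal elementary abelian
`p`-extension unramified outside `S` of the fixed field of `H`. -/
def elementaryAbelianGenerators (S : Set (Place K)) (p : ℕ) (H : Subgroup (Kb ≃ₐ[K] Kb)) :
    Set (Kb ≃ₐ[K] Kb) :=
  {σ | (∃ g ∈ H, ∃ h ∈ H, σ = g * h * g⁻¹ * h⁻¹) ∨ (∃ g ∈ H, σ = g ^ p) ∨
    σ ∈ H ∧ ∃ x ∉ S, ∃ z : Place Kb, z.LiesOver x ∧ σ ∈ z.inertia K}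

theorem elementaryAbelianGenerators_subset (S : Set (Place K)) (p : ℕ)
    (H : Subgroup (Kb ≃ₐ[K] Kb)) : elementaryAbelianGenerators S p H ⊆ H := by
  rintro σ (⟨g, hg, h, hh, rfl⟩ | ⟨g, hg, rfl⟩ | ⟨h, -⟩)
  · exact mul_mem (mul_mem (mul_mem hg hh) (inv_mem hg)) (inv_mem hh)
  · exact pow_mem hg p
  · exact h

theorem Place.conj_mem_inertia {z : Place Kb} {x : Place K} (hz : z.LiesOver x)
    (g : Kb ≃ₐ[K] Kb) {σ : Kb ≃ₐ[K] Kb} (hσ : σ ∈ z.inertia K) :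
    ∃ z' : Place Kb, z'.LiesOver x ∧ g * σ * g⁻¹ ∈ z'.inertia K := by
  match z, x, hz with
  | finite V hV, finite A _, hz =>
    obtain ⟨h1, h2⟩ := mem_inertia_finite_iff.mp hσ
    refine ⟨finite (g • V) fun h => hV ?_, ?_, mem_inertia_finite_iff.mpr ⟨?_, fun x hx => ?_⟩⟩
    · ext x
      have : g • x ∈ g • V := h ▸ trivial
      rw [ValuationSubring.smul_mem_pointwise_smul_iff] at this
      exact ⟨fun _ => trivial, fun _ => this⟩
    · have hz' : V.comap (algebraMap K Kb) = A := hz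
      change (g • V).comap (algebraMap K Kb) = A
      rw [← hz']
      ext a
      rw [ValuationSubring.mem_comap, ValuationSubring.mem_comap]
      have : algebraMap K Kb a = g • algebraMap K Kb a := (g.commutes a).symm
      conv_lhs => rw [this]
      exact ValuationSubring.smul_mem_pointwise_smul_iff
    · rw [smul_smul, inv_mul_cancel_right, mul_smul, h1]
    · obtain ⟨x, hxV, rfl⟩ := (ValuationSubring.mem_smul_pointwise_iff_exists _ _ _).mp hx
      have h3 : (g * σ * g⁻¹) (g • x) - g • x = g • (σ x - x) := by
        change (g * σ * g⁻¹) • (g • x) - g • x = _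
        rw [smul_smul, inv_mul_cancel_right, mul_smul, smul_sub]
        rfl
      rw [h3]
      exact smul_mem_nonunits_of_smul_eq rfl (h2 x hxV)
  | infinite c, infinite a, hz =>
    have hz' : c.comap (algebraMap K Kb) = a := hz
    have h1 : σ • c = c := hσ
    refine ⟨infinite (g • c), ?_, ?_⟩
    · change (g • c).comap (algebraMap K Kb) = a
      rw [← hz', NumberField.InfinitePlace.comap_smul]
      congr 1
      ext a
      exact g.symm.commutes a
    · change (g * σ * g⁻¹) • g • c = g • c
      rw [smul_smul, inv_mul_cancel_right, mul_smul, h1]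

theorem conj_mem_elementaryAbelianGenerators {S : Set (Place K)} {p : ℕ}
    {H : Subgroup (Kb ≃ₐ[K] Kb)} {g : Kb ≃ₐ[K] Kb} (hg : ∀ h ∈ H, g * h * g⁻¹ ∈ H)
    {σ : Kb ≃ₐ[K] Kb} (hσ : σ ∈ elementaryAbelianGenerators S p H) :
    g * σ * g⁻¹ ∈ elementaryAbelianGenerators S p H := by
  obtain ⟨a, ha, b, hb, rfl⟩ | ⟨a, ha, rfl⟩ | ⟨h, x, hx, z, hz, hσ⟩ := hσ
  · exact .inl ⟨_, hg a ha, _, hg b hb, by group⟩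
  · exact .inr (.inl ⟨_, hg a ha, by rw [conj_pow]⟩)
  · obtain ⟨z', hz', h'⟩ := Place.conj_mem_inertia hz g hσ
    exact .inr (.inr ⟨hg _ h, x, hx, z', hz', h'⟩)

theorem Place.restrictScalars_mem_inertia_iff {F : IntermediateField K Kb} {z : Place Kb}
    {σ : Kb ≃ₐ[F] Kb} : σ.restrictScalars K ∈ z.inertia K ↔ σ ∈ z.inertia F := by
  match z with
  | finite V hV => rw [mem_inertia_finite_iff, mem_inertia_finite_iff]; rfl
  | infinite c => exact Iff.rfl

theorem restrictScalars_mem_fixingSubgroup {F : IntermediateField K Kb} (σ : Kb ≃ₐ[F] Kb) :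
    σ.restrictScalars K ∈ F.fixingSubgroup := by
  rw [IntermediateField.mem_fixingSubgroup_iff]
  exact fun x hx => σ.commutes ⟨x, hx⟩

/-- Restricted to an elementary abelian `M/F` unramified outside `S`, commutators and `p`-th powers
are trivial, and so is inertia, which restricts to inertia. -/
theorem maxElementaryAbelian_le (S : Set (Place K)) (p : ℕ) (F : IntermediateField K Kb) {σ : _}
    (hσ : σ ∈ elementaryAbelianGenerators S p F.fixingSubgroup) {m : Kb}
    (hm : m ∈ maxElementaryAbelian S p F) : σ m = m := by
  have hσF : σ ∈ F.fixingSubgroup := elementaryAbelianGenerators_subset S p _ hσ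
  let toF : F.fixingSubgroup ≃* (Kb ≃ₐ[F] Kb) := F.fixingSubgroupEquiv
  -- Fixing is phrased as containment in a fixed field, so that the compositum may be tested on each
  -- `M` separately.
  suffices sSup {M : IntermediateField F Kb | IsElementaryAbelian p F M ∧
      IsUnramifiedOutside S F M} ≤
      IntermediateField.fixedField (Subgroup.zpowers (toF ⟨σ, hσF⟩)) from
    this hm ⟨_, Subgroup.mem_zpowers _⟩
  refine sSup_le fun M ⟨⟨hgal, hcomm, hpow⟩, hur⟩ m hm => ?_
  suffices hs : σ m = m by
    have h1 : toF ⟨σ, hσF⟩ ∈ MulAction.stabilizer (Kb ≃ₐ[F] Kb) m := hs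
    rintro ⟨τ, hτ⟩
    exact (Subgroup.zpowers_le.mpr h1) hτ
  have key : ∀ g (hg : g ∈ F.fixingSubgroup) (a : M),
      g (a : Kb) = ((toF ⟨g, hg⟩).restrictNormal M a : Kb) :=
    fun g hg a => ((toF ⟨g, hg⟩).restrictNormal_commutes M a).symm
  obtain ⟨g, hg, h, hh, rfl⟩ | ⟨g, hg, rfl⟩ | ⟨h, x, hx, z, hz, hσ⟩ := hσ
  · obtain ⟨m', hm'⟩ : ∃ m' : M, (m' : Kb) = (h * g)⁻¹ m :=
      ⟨_, (key _ (inv_mem (mul_mem hh hg)) ⟨m, hm⟩).symm⟩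
    have h1 : m = h (g m') := by
      rw [hm']; exact ((h * g).apply_symm_apply m).symm
    have h2 : (g * h * g⁻¹ * h⁻¹) m = g (h m') := by
      have h3 : g * h * g⁻¹ * h⁻¹ = g * h * (h * g)⁻¹ := by group
      rw [h3, hm']; rfl
    rw [h2, key h hh, key g hg, ← AlgEquiv.mul_apply, hcomm, AlgEquiv.mul_apply, ← key h hh,
      ← key g hg, ← h1]
  · have h1 : ∀ (j : ℕ) (a : M), (g ^ j) (a : Kb) =
        (((toF ⟨g, hg⟩).restrictNormal M ^ j) a : M) := by
      intro j
      induction j with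
      | zero => exact fun a => rfl
      | succ j ih =>
        intro a
        rw [pow_succ, AlgEquiv.mul_apply, key g hg, ih, pow_succ]
        rfl
    rw [h1 p ⟨m, hm⟩, hpow]
    rfl
  · have : IsScalarTower K M Kb := IsScalarTower.of_algebraMap_eq fun _ => rfl
    obtain ⟨y, hzy, hyx⟩ := hz.exists_between (M := M)
    have h1 : toF ⟨σ, hσF⟩ ∈ z.inertia F := Place.restrictScalars_mem_inertia_iff.mp hσ
    have h2 := Place.restrict_mem_inertia hzy h1 (τ := (toF ⟨σ, hσF⟩).restrictNormal M)
      (fun a => key σ hσF a)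
    rw [hur x hx y hyx, Subgroup.mem_bot] at h2
    rw [key σ hσF ⟨m, hm⟩, h2]
    rfl

variable [IsSepClosure K Kb]

/-- The field fixed by all generators is itself one of the extensions in the compositum: it is
normal because the generators are stable under conjugation, and its automorphisms, as well as its
inertia elements, lift to `Kb`, where the corresponding generators act trivially on it. -/
theorem le_maxElementaryAbelian (S : Set (Place K)) (p : ℕ) (F : IntermediateField K Kb) {m : Kb}
    (hm : ∀ σ ∈ elementaryAbelianGenerators S p F.fixingSubgroup, σ m = m) :
    m ∈ maxElementaryAbelian S p F := by
  set N := Subgroup.closure (elementaryAbelianGenerators S p F.fixingSubgroup)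
  have hN : ∀ {a : Kb}, a ∈ IntermediateField.fixedField N ↔
      ∀ σ ∈ elementaryAbelianGenerators S p F.fixingSubgroup, σ a = a := by
    intro a
    refine ⟨fun h σ hσ => h ⟨σ, Subgroup.subset_closure hσ⟩, fun h => ?_⟩
    rintro ⟨σ, hσ⟩
    exact (Subgroup.closure_le (MulAction.stabilizer (Kb ≃ₐ[K] Kb) a)).mpr h hσ
  have hF : F ≤ IntermediateField.fixedField N := fun a ha => hN.mpr fun σ hσ =>
    (IntermediateField.mem_fixingSubgroup_iff _ _).mp
      (elementaryAbelianGenerators_subset S p _ hσ) a ha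
  set M : IntermediateField F Kb := IntermediateField.extendScalars hF
  have hM : ∀ {a : Kb}, a ∈ M ↔ ∀ σ ∈ elementaryAbelianGenerators S p F.fixingSubgroup, σ a = a :=
    hN
  have hnormal : Normal F M := by
    rw [IntermediateField.normal_iff_forall_map_le']
    rintro g _ ⟨a, ha, rfl⟩
    have ha' := hM.mp ha
    refine hM.mpr fun σ hσ => ?_
    set g' := g.restrictScalars K
    have hg' : g'⁻¹ ∈ F.fixingSubgroup := inv_mem (restrictScalars_mem_fixingSubgroup g)
    have h1 := ha' _ (conj_mem_elementaryAbelianGenerators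
      (fun h hh => mul_mem (mul_mem hg' hh) (inv_mem hg')) hσ)
    have h2 := congrArg g' h1
    rw [inv_inv] at h2
    have h3 : g' ((g'⁻¹ * σ * g') a) = σ (g a) := g'.apply_symm_apply (σ (g a))
    rw [h3] at h2
    exact h2
  have hgal : IsGalois F M := ⟨⟩
  suffices hmem : IsElementaryAbelian p F M ∧ IsUnramifiedOutside S F M from
    (le_sSup hmem : M ≤ _) (hM.mpr hm)
  have hlift : ∀ (σ : M ≃ₐ[F] M) (a : M), (σ.liftNormal Kb).restrictScalars K (a : Kb) = σ a :=
    fun σ a => σ.liftNormal_commutes Kb a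
  refine ⟨⟨hgal, fun σ τ => AlgEquiv.ext fun a => Subtype.ext ?_,
    fun σ => AlgEquiv.ext fun a => Subtype.ext ?_⟩, fun x hx y hy => ?_⟩
  · set σ' := (σ.liftNormal Kb).restrictScalars K
    set τ' := (τ.liftNormal Kb).restrictScalars K
    have h1 := hM.mp (τ (σ a)).2 _ (.inl ⟨_, restrictScalars_mem_fixingSubgroup (σ.liftNormal Kb), _,
      restrictScalars_mem_fixingSubgroup (τ.liftNormal Kb), rfl⟩)
    have h2 : ((τ (σ a) : M) : Kb) = τ' (σ' a) := by rw [hlift, hlift]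
    have h3 : ((σ (τ a) : M) : Kb) = σ' (τ' a) := by rw [hlift, hlift]
    change ((σ (τ a) : M) : Kb) = (τ (σ a) : M)
    rw [← h1, h2, h3]
    change _ = (σ' * τ' * σ'⁻¹ * τ'⁻¹) ((τ' * σ') (a : Kb))
    have h4 : σ' * τ' * σ'⁻¹ * τ'⁻¹ * (τ' * σ') = σ' * τ' := by group
    exact (congrArg (fun f : Kb ≃ₐ[K] Kb => f a) h4).symm
  · have h1 := hM.mp a.2 _ (.inr (.inl ⟨_, restrictScalars_mem_fixingSubgroup (σ.liftNormal Kb),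
      rfl⟩))
    have h2 : ∀ (j : ℕ) (a : M), (((σ.liftNormal Kb).restrictScalars K) ^ j) (a : Kb) =
        ((σ ^ j) a : M) := by
      intro j
      induction j with
      | zero => exact fun a => rfl
      | succ j ih =>
        intro a
        rw [pow_succ, AlgEquiv.mul_apply, hlift, ih, pow_succ]
        rfl
    rw [← h2, h1]
    rfl
  · rw [eq_bot_iff]
    intro τ hτ
    have : IsScalarTower K M Kb := IsScalarTower.of_algebraMap_eq fun _ => rfl
    obtain ⟨z, hz, σ, hσ, hστ⟩ := Place.exists_lift_inertia (L := Kb) hτ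
    refine Subgroup.mem_bot.mpr (AlgEquiv.ext fun a => Subtype.ext ?_)
    have h1 := hM.mp a.2 (σ.restrictScalars K) (.inr (.inr
      ⟨restrictScalars_mem_fixingSubgroup σ, x, hx, z, hz.trans hy,
        Place.restrictScalars_mem_inertia_iff.mpr hσ⟩))
    exact (hστ a).symm.trans h1

theorem mem_maxElementaryAbelian_iff (S : Set (Place K)) (p : ℕ) (F : IntermediateField K Kb)
    {m : Kb} : m ∈ maxElementaryAbelian S p F ↔
      ∀ σ ∈ elementaryAbelianGenerators S p F.fixingSubgroup, σ m = m :=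
  ⟨fun hm _ hσ => maxElementaryAbelian_le S p F hσ hm, le_maxElementaryAbelian S p F⟩

/-- Each step is defined intrinsically from the previous one: an automorphism over `K` preserving
the step `i` conjugates its generators among themselves, so it preserves the step `i + 1`. -/
theorem apply_mem_tower (S : Set (Place K)) (p i : ℕ) (g : Kb ≃ₐ[K] Kb) {m : Kb}
    (hm : m ∈ tower Kb S p i) : g m ∈ tower Kb S p i := by
  induction i generalizing g m with
  | zero =>
    obtain ⟨a, rfl⟩ := IntermediateField.mem_bot.mp hm
    rw [g.commutes]
    exact hm
  | succ i ih =>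
    refine (mem_maxElementaryAbelian_iff S p _).mpr fun σ hσ => ?_
    have hconj : ∀ h ∈ (tower Kb S p i).fixingSubgroup,
        g⁻¹ * h * g⁻¹⁻¹ ∈ (tower Kb S p i).fixingSubgroup := by
      intro h hh
      rw [IntermediateField.mem_fixingSubgroup_iff] at hh ⊢
      intro a ha
      rw [inv_inv]
      change g.symm (h (g a)) = a
      rw [hh _ (ih g ha), g.symm_apply_apply]
    have h1 := (mem_maxElementaryAbelian_iff S p _).mp hm _
      (conj_mem_elementaryAbelianGenerators hconj hσ)
    have h2 := congrArg g h1
    rw [inv_inv] at h2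
    have h3 : g ((g⁻¹ * σ * g) m) = σ (g m) := g.apply_symm_apply _
    rw [h3] at h2
    exact h2

theorem normal_tower (S : Set (Place K)) (p i : ℕ) : Normal K (tower Kb S p i) := by
  rw [IntermediateField.normal_iff_forall_map_le']
  rintro g _ ⟨a, ha, rfl⟩
  exact apply_mem_tower S p i g ha

theorem pow_mem_fixingSubgroup_tower (S : Set (Place K)) (p i : ℕ) (g : Kb ≃ₐ[K] Kb) :
    g ^ p ^ i ∈ (tower Kb S p i).fixingSubgroup := by
  induction i with
  | zero =>
    change _ ∈ (⊥ : IntermediateField K Kb).fixingSubgroup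
    rw [IntermediateField.fixingSubgroup_bot]
    trivial
  | succ i ih =>
    rw [IntermediateField.mem_fixingSubgroup_iff]
    intro m hm
    exact (mem_maxElementaryAbelian_iff S p _).mp hm _ (.inr (.inl ⟨_, ih, by rw [pow_succ, pow_mul]⟩))

/-- A descending sequence of closed subgroups with elementary abelian successive quotients,
containing the inertia groups outside `S`, contains the groups fixing the steps of the tower. -/
theorem fixingSubgroup_tower_le (S : Set (Place K)) (p : ℕ) (U : ℕ → Subgroup (Kb ≃ₐ[K] Kb))
    (hclosed : ∀ i, IsClosed (U i : Set (Kb ≃ₐ[K] Kb))) (h0 : U 0 = ⊤)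
    (hcomm : ∀ i, ∀ g ∈ U i, ∀ h ∈ U i, g * h * g⁻¹ * h⁻¹ ∈ U (i + 1))
    (hpow : ∀ i, ∀ g ∈ U i, g ^ p ∈ U (i + 1))
    (hur : ∀ i, ∀ x ∉ S, ∀ z : Place Kb, z.LiesOver x → z.inertia K ≤ U i) (i : ℕ) :
    (tower Kb S p i).fixingSubgroup ≤ U i := by
  induction i with
  | zero => rw [h0]; exact le_top
  | succ i ih =>
    have h1 : elementaryAbelianGenerators S p (tower Kb S p i).fixingSubgroup ⊆ U (i + 1) := by
      rintro σ (⟨g, hg, h, hh, rfl⟩ | ⟨g, hg, rfl⟩ | ⟨h, x, hx, z, hz, hσ⟩)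
      · exact hcomm i g (ih hg) h (ih hh)
      · exact hpow i g (ih hg)
      · exact hur (i + 1) x hx z hz hσ
    have h2 : IntermediateField.fixedField (U (i + 1)) ≤ tower Kb S p (i + 1) := fun m hm =>
      (mem_maxElementaryAbelian_iff S p _).mpr fun σ hσ => hm ⟨σ, h1 hσ⟩
    have h3 := IntermediateField.fixingSubgroup_le h2
    -- Closedness is what allows `U (i + 1)` to be recovered from its fixed field.
    rwa [InfiniteGalois.fixingSubgroup_fixedField (⟨U (i + 1), hclosed (i + 1)⟩ :
      ClosedSubgroup (Kb ≃ₐ[K] Kb))] at h3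

end TowerGroups

/-! ### Residually scalar homomorphisms to an order -/

section ResiduallyScalar

open scoped TensorProduct
open IsLocalRing

theorem one_tmul_eq_iff {O A : Type*} [CommRing O] [IsLocalRing O] [AddCommGroup A] [Module O A]
    (x y : A) : (1 : ResidueField O) ⊗ₜ[O] x = 1 ⊗ₜ[O] y ↔
      x - y ∈ maximalIdeal O • (⊤ : Submodule O A) := by
  have h := TensorProduct.quotTensorEquivQuotSMul_mk_one_tmul (R := O) (M := A) (maximalIdeal O)
  have hinj := (TensorProduct.quotTensorEquivQuotSMul A (maximalIdeal O)).injective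
  rw [← Submodule.Quotient.eq]
  exact ⟨fun e => (h x).symm.trans ((congrArg _ e).trans (h y)),
    fun e => hinj ((h x).trans (e.trans (h y).symm))⟩

theorem isNilpotent_one_tmul_sub {O A : Type*} [CommRing O] [IsLocalRing O] [Ring A] [Algebra O A]
    {a : A} {P : Polynomial O} (hP : Polynomial.aeval a P = 0) {x : ResidueField O} {m : ℕ}
    (hx : P.map (residue O) = (Polynomial.X - Polynomial.C x) ^ m) :
    IsNilpotent ((1 : ResidueField O) ⊗ₜ[O] a -
      algebraMap (ResidueField O) (ResidueField O ⊗[O] A) x) := by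
  refine ⟨m, ?_⟩
  have h1 : Polynomial.aeval ((1 : ResidueField O) ⊗ₜ[O] a) (P.map (residue O)) = 0 := by
    have h2 := Polynomial.aeval_algHom_apply
      (Algebra.TensorProduct.includeRight (R := O) (A := ResidueField O) (B := A)) a P
    rw [hP, map_zero] at h2
    rw [← h2]
    exact Polynomial.aeval_map_algebraMap (ResidueField O) _ P
  rw [hx] at h1
  simpa using h1

/-- `U` is the unipotent filtration of the residual image twisted by `χ⁻¹`. The clause on congruent
values of `φ` serves to prove that the `U i` are closed and contain kernels; the last clause is the
Nakayama argument. -/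
theorem exists_unipotent_subgroups {O A G N : Type*} [CommRing O] [IsLocalRing O] [Ring A]
    [Algebra O A] [Module.Finite O A] [Module.Free O A] [Nontrivial A] [Group G]
    [AddCommGroup N] [Module O N]
    (p : ℕ) [Fact p.Prime] [CharP (ResidueField O) p] [Finite (ResidueField O)]
    (φ : G →* A) (hφ : Submodule.span O (Set.range φ) = ⊤) (χ : G →* (ResidueField O)ˣ)
    (hχ : ∀ g, IsNilpotent ((1 : ResidueField O) ⊗ₜ[O] φ g -
      algebraMap (ResidueField O) (ResidueField O ⊗[O] A) (χ g)))
    {d : ℕ} (hd : Module.finrank O A ≤ d) :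
    ∃ U : ℕ → Subgroup G, U 0 = ⊤ ∧
      (∀ i, ∀ g ∈ U i, ∀ h ∈ U i, g * h * g⁻¹ * h⁻¹ ∈ U (i + 1)) ∧
      (∀ i, ∀ g ∈ U i, g ^ p ∈ U (i + 1)) ∧
      (∀ i g h, φ g - φ h ∈ maximalIdeal O • (⊤ : Submodule O A) → g ∈ U i → h ∈ U i) ∧
      ∀ h, d ≤ 2 ^ h → ∀ δ : A →ₗ[O] N,
        (∀ g, ∃ f, g * f⁻¹ ∈ U h ∧ δ (φ f) = 0) → δ = 0 := by
  let k := ResidueField O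
  let R := k ⊗[O] A
  have hrank : Module.finrank k R = Module.finrank O A := Module.finrank_baseChange
  have hpos : 0 < Module.finrank O A := Module.finrank_pos_iff_of_free O A |>.mpr inferInstance
  have hR : Nontrivial R := Module.nontrivial_of_finrank_pos (R := k) (hrank ▸ hpos)
  have hfin : Finite R := Module.finite_of_finite k
  have hchar : CharP R p := charP_of_injective_algebraMap (algebraMap k R).injective p
  let π : G →* R := (Algebra.TensorProduct.includeRight (R := O) (A := k) (B := A)).toMonoidHom.comp φ
  have hπ : ∀ g, π g = (1 : k) ⊗ₜ[O] φ g := fun g => rfl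
  let f : G →* Rˣ := MonoidHom.mk' (fun g => Units.map (algebraMap k R).toMonoidHom (χ g)⁻¹ *
      π.toHomUnits g) fun a b => by
    ext
    simp only [map_mul, mul_inv_rev, Units.val_mul, Units.coe_map, MonoidHom.coe_toHomUnits]
    have := Algebra.commutes ((χ a)⁻¹ * (χ b)⁻¹ : kˣ).1 (π a)
    have h2 := Algebra.commutes ((χ b)⁻¹ : kˣ).1 (π a)
    change algebraMap k R _ * algebraMap k R _ * (π a * π b) =
      algebraMap k R _ * π a * (algebraMap k R _ * π b)
    rw [← map_mul, mul_assoc, ← mul_assoc (π a), ← h2, ← mul_assoc, ← mul_assoc, ← mul_assoc,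
      ← map_mul, mul_comm]
  have hfval : ∀ g, (f g : R) = ((χ g)⁻¹ : kˣ).1 • π g := fun g => by
    rw [Algebra.smul_def]; rfl
  have hπf : ∀ g, π g = (χ g : k) • (f g : R) := fun g => by rw [hfval, smul_smul]; simp
  have hspan : Submodule.span k (Set.range fun g => (f g : R)) = ⊤ := by
    refine top_le_iff.mp fun z hz => ?_
    induction z using TensorProduct.induction_on with
    | zero => exact zero_mem _
    | add x y hx hy => exact add_mem (hx trivial) (hy trivial)
    | tmul c a =>
      have ha : a ∈ Submodule.span O (Set.range φ) := hφ ▸ Submodule.mem_top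
      have hc : c ⊗ₜ[O] a = c • ((1 : k) ⊗ₜ[O] a) := by
        rw [TensorProduct.smul_tmul', smul_eq_mul, mul_one]
      rw [hc]
      refine Submodule.smul_mem _ _ ?_
      clear hc hz
      induction ha using Submodule.span_induction with
      | mem x hx =>
        obtain ⟨g, rfl⟩ := hx
        rw [← hπ, hπf]
        exact Submodule.smul_mem _ _ (Submodule.subset_span ⟨g, rfl⟩)
      | zero => simp
      | add x y _ _ hx hy => rw [TensorProduct.tmul_add]; exact add_mem hx hy
      | smul r x _ hx =>
        rw [TensorProduct.tmul_smul, ← algebraMap_smul k r]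
        exact Submodule.smul_mem _ _ hx
  have hnil : ∀ g, IsNilpotent ((f g : R) - 1) := fun g => by
    have : (f g : R) - 1 = ((χ g)⁻¹ : kˣ).1 • (π g - algebraMap k R (χ g)) := by
      rw [smul_sub, ← hfval, Algebra.algebraMap_eq_smul_one, smul_smul]; simp
    rw [this]
    exact (hχ g).smul _
  refine ⟨fun i => unipotentFiltration hspan i, unipotentFiltration_zero hspan, ?_, ?_, ?_, ?_⟩
  · exact fun i g hg h hh => commutator_mem_unipotentFiltration hspan hg hh
  · exact fun i g hg => pow_mem_unipotentFiltration hspan p hg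
  · intro i g h hgh hg
    have e : π g = π h := (one_tmul_eq_iff _ _).mpr hgh
    -- The scalar is determined by the residual image: two scalars differing from the same element
    -- by nilpotents differ by a nilpotent, hence are equal.
    have e2 : χ g = χ h := by
      have h1 : IsNilpotent (algebraMap k R ((χ g : k) - χ h)) := by
        have h2 : algebraMap k R ((χ g : k) - χ h) =
            (π h - algebraMap k R (χ h)) - (π g - algebraMap k R (χ g)) := by
          rw [e, map_sub]; abel
        rw [h2]
        refine Commute.isNilpotent_sub ?_ (hχ h) (hχ g)
        change Commute (π h - algebraMap k R (χ h)) (π g - algebraMap k R (χ g))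
        rw [e]
        have h3 := fun c => (Algebra.commutes (R := k) c (π h))
        refine Commute.sub_left (Commute.sub_right rfl (h3 _).symm) ?_
        exact Algebra.commutes _ _
      rw [IsNilpotent.map_iff (algebraMap k R).injective, isNilpotent_iff_eq_zero, sub_eq_zero] at h1
      exact Units.ext h1
    have e3 : (f g : R) = f h := by rw [hfval, hfval, e, e2]
    rw [mem_unipotentFiltration] at hg ⊢
    rwa [← e3]
  · intro h hh δ hδ
    -- As `d ≤ 2 ^ h`, the relevant power of the augmentation ideal is zero, so elements of level
    -- `h` act residually as scalars.
    have hV : ∀ g ∈ unipotentFiltration hspan h, (f g : R) = 1 := fun g hg => by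
      have h1 := augmentation_pow_finrank p hspan hnil (hrank.le.trans (hd.trans hh))
      rw [mem_unipotentFiltration, h1] at hg
      exact sub_eq_zero.mp hg
    -- If `c` lifts the scalar `χ (g * b⁻¹)`, then `φ g ≡ c • φ b` modulo the maximal ideal, and `δ`
    -- kills `φ b`.
    have hle : LinearMap.range δ ≤ maximalIdeal O • LinearMap.range δ := by
      have hspan' : LinearMap.range δ = Submodule.span O (δ '' Set.range φ) := by
        rw [← Submodule.map_span, hφ, LinearMap.range_eq_map]
      conv_lhs => rw [hspan']
      rw [Submodule.span_le]
      rintro _ ⟨_, ⟨g, rfl⟩, rfl⟩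
      obtain ⟨b, hb, hb0⟩ := hδ g
      obtain ⟨c, hc⟩ := residue_surjective (R := O) (χ (g * b⁻¹) : k)
      have h1 : π g = (χ (g * b⁻¹) : k) • π b := by
        have h2 : π g = π (g * b⁻¹) * π b := by rw [← map_mul]; simp
        rw [h2, hπf (g * b⁻¹), hV _ hb, smul_mul_assoc, one_mul]
      have h3 : φ g - c • φ b ∈ maximalIdeal O • (⊤ : Submodule O A) := by
        rw [← one_tmul_eq_iff]
        refine h1.trans ?_
        rw [← hc, TensorProduct.tmul_smul, hπ]
        rw [← algebraMap_smul (ResidueField O) c]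
        rfl
      have h4 : δ (φ g) = δ (φ g - c • φ b) := by simp [hb0]
      rw [SetLike.mem_coe, h4, LinearMap.range_eq_map, ← Submodule.map_smul'']
      exact Submodule.mem_map_of_mem h3
    have h0 := Submodule.eq_bot_of_le_smul_of_le_jacobson_bot _ _
      (Module.Finite.iff_fg.mp inferInstance) hle (IsLocalRing.maximalIdeal_le_jacobson _)
    exact LinearMap.range_eq_bot.mp h0

end ResiduallyScalar

/-! ### Integral characteristic polynomials -/

section IntegralCharpoly

open IsLocalRing Polynomial

/-- With `q = |k|`, the power `l ^ q` is again a root of `f`, whose only root is `l`. So `l` is a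
root of `X ^ q - X`, which splits over `k` with root set `k`. -/
theorem exists_eq_X_sub_C_pow {k L : Type*} [Field k] [Finite k] [Field L] [Algebra k L]
    {f : k[X]} {l : L} {n : ℕ} (hn : n ≠ 0) (h : f.map (algebraMap k L) = (X - C l) ^ n) :
    ∃ m : k, algebraMap k L m = l ∧ f = (X - C m) ^ n := by
  have := Fintype.ofFinite k
  set q := Fintype.card k with hq
  have h1 : l ^ q = l := by
    have h2 : aeval (l ^ q) f = 0 := by
      rw [← expand_aeval, FiniteField.expand_card, map_pow, ← eval_map_algebraMap, h]
      simp [hn, Fintype.card_ne_zero]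
    rw [← eval_map_algebraMap, h] at h2
    simpa [hn, sub_eq_zero] using h2
  have h3 : (X ^ q - X : k[X]) = (Multiset.map (fun a => X - C a) Finset.univ.val).prod := by
    have h4 := FiniteField.X_pow_card_sub_X_natDegree_eq k (p := q) Fintype.one_lt_card
    have h5 : (X ^ q - X : k[X]).Monic := by
      apply monic_X_pow_sub
      simpa using Fintype.one_lt_card (α := k)
    rw [← FiniteField.roots_X_pow_card_sub_X k]
    refine (prod_multiset_X_sub_C_of_monic_of_roots_card_eq h5 ?_).symm
    rw [FiniteField.roots_X_pow_card_sub_X k, h4]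
    rfl
  have h6 := congrArg (fun f : k[X] => aeval l f) h3
  simp only [map_sub, map_pow, aeval_X, h1, sub_self, map_multiset_prod] at h6
  obtain ⟨m, hm⟩ : ∃ m : k, algebraMap k L m = l := by
    have h7 := Multiset.prod_eq_zero_iff.mp h6.symm
    simp only [Multiset.map_map, Multiset.mem_map, Function.comp_apply, aeval_sub, aeval_X, aeval_C,
      sub_eq_zero] at h7
    obtain ⟨m, -, hm⟩ := h7
    exact ⟨m, hm.symm⟩
  refine ⟨m, hm, map_injective _ (algebraMap k L).injective ?_⟩
  rw [h, ← hm]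
  simp

variable (p : ℕ) [Fact p.Prime] {E : Type u} [NormedField E] [NormedAlgebra ℚ_[p] E]

theorem isUnit_ringOfIntegers_iff (x : ringOfIntegers p E) : IsUnit x ↔ ‖(x : E)‖ = 1 := by
  constructor
  · rintro ⟨y, rfl⟩
    have h1 := (mem_ringOfIntegers p E _).mp (y : ringOfIntegers p E).2
    have h2 := (mem_ringOfIntegers p E _).mp (y⁻¹ : (ringOfIntegers p E)ˣ).val.2
    have h3 : ‖((y : ringOfIntegers p E) : E)‖ * ‖((y⁻¹ : (ringOfIntegers p E)ˣ).val : E)‖ = 1 := by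
      rw [← norm_mul, ← norm_one (α := E)]
      congr 1
      exact_mod_cast congrArg Subtype.val y.mul_inv
    have h4 := norm_nonneg ((y⁻¹ : (ringOfIntegers p E)ˣ).val : E)
    nlinarith [norm_nonneg ((y : ringOfIntegers p E) : E)]
  · intro h
    have h0 : (x : E) ≠ 0 := by
      intro h0
      simp [h0] at h
    refine IsUnit.of_mul_eq_one ⟨(x : E)⁻¹, (mem_ringOfIntegers p E _).mpr (by simp [h])⟩ ?_
    exact Subtype.ext (mul_inv_cancel₀ h0)

theorem mem_maximalIdeal_ringOfIntegers_iff (x : ringOfIntegers p E) :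
    x ∈ maximalIdeal (ringOfIntegers p E) ↔ ‖(x : E)‖ < 1 := by
  rw [mem_maximalIdeal, mem_nonunits_iff, isUnit_ringOfIntegers_iff]
  have := (mem_ringOfIntegers p E _).mp x.2
  exact ⟨lt_of_le_of_ne this, ne_of_lt⟩

theorem exists_lift_of_norm_coeff_le {P : E[X]} (h : ∀ j, ‖P.coeff j‖ ≤ 1) :
    ∃ f : (ringOfIntegers p E)[X], f.map (algebraMap (ringOfIntegers p E) E) = P := by
  rw [← mem_lifts, lifts_iff_coeff_lifts]
  exact fun j => ⟨⟨_, (mem_ringOfIntegers p E _).mpr (h j)⟩, rfl⟩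

theorem residue_map_eq_of_isCongruentToPow {f : (ringOfIntegers p E)[X]} {l : ringOfIntegers p E}
    {n : ℕ} (h : IsCongruentToPow (f.map (algebraMap (ringOfIntegers p E) E)) (l : E) n) :
    f.map (residue _) = (X - C (residue _ l)) ^ n := by
  have h1 : f.map (residue _) - (X - C (residue _ l)) ^ n =
      (f - (X - C l) ^ n).map (residue _) := by simp
  rw [← sub_eq_zero, h1]
  ext j
  rw [coeff_map, coeff_zero, residue_eq_zero_iff, mem_maximalIdeal_ringOfIntegers_iff]
  have h2 := h.2 j
  have h3 : f.map (algebraMap (ringOfIntegers p E) E) - (X - C (l : E)) ^ n =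
      (f - (X - C l) ^ n).map (algebraMap (ringOfIntegers p E) E) := by
    simp
  rw [h3, coeff_map] at h2
  exact h2

/-- The constant term is congruent to the unit `(-l) ^ n`, so the scaled matrix has determinant of
norm one. That norm is also `‖ϖ‖ ^ (-a * n)`, with `‖ϖ‖ < 1`. -/
theorem eq_zero_of_isCongruentToPow [IsUltrametricDist E] {n : ℕ} (hn : n ≠ 0)
    {M : Matrix (Fin n) (Fin n) E} (hM : ‖M.det‖ = 1) {ϖ l : E} (hϖ : IsUniformizer ϖ) {a : ℤ}
    (hl : ‖l‖ = 1) (h : IsCongruentToPow (ϖ ^ (-a) • M).charpoly l n) : a = 0 := by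
  have h1 := h.2 0
  set x := (ϖ ^ (-a) • M).charpoly.coeff 0 with hx
  set y := ((X - C l) ^ n).coeff 0 with hy
  have hy1 : ‖y‖ = 1 := by
    rw [hy, coeff_zero_eq_eval_zero]
    simp [hl]
  rw [coeff_sub, ← hx, ← hy] at h1
  have hx1 : ‖x‖ = 1 := by
    have h2 := IsUltrametricDist.norm_add_le_max (x - y) y
    have h3 := IsUltrametricDist.norm_add_le_max x (-(x - y))
    rw [sub_add_cancel, hy1, max_eq_right h1.le] at h2
    rw [← sub_eq_add_neg, sub_sub_cancel, hy1, norm_neg] at h3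
    rcases le_max_iff.mp h3 with h4 | h4
    · exact le_antisymm h2 h4
    · exact absurd h1 (not_lt.mpr h4)
  have h5 : ‖(ϖ ^ (-a) • M).det‖ = 1 := by
    rw [Matrix.det_eq_sign_charpoly_coeff, norm_mul, ← hx, hx1]
    simp
  rw [Matrix.det_smul, norm_mul, hM, mul_one, norm_pow, norm_zpow, Fintype.card_fin,
    pow_eq_one_iff_of_nonneg (by positivity) hn] at h5
  by_contra ha
  have hϖ0 : 0 < ‖ϖ‖ := norm_pos_iff.mpr hϖ.1
  rw [zpow_eq_one_iff_right₀ hϖ0.le hϖ.2.1.ne] at h5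
  omega

theorem norm_charpoly_coeff_le {F : Type u} [NormedField F] [NormedAlgebra E F] {n : ℕ}
    {M : Matrix (Fin n) (Fin n) E} {l : F}
    (h : IsCongruentToPow (M.map (algebraMap E F)).charpoly l n) (j : ℕ) :
    ‖M.charpoly.coeff j‖ ≤ 1 := by
  have := h.1 j
  rwa [Matrix.charpoly_map, coeff_map, norm_algebraMap'] at this

/-- The common residual eigenvalue lives a priori in the residue field of `F`; it descends because
the reduced characteristic polynomials have coefficients in the finite residue field of `E`. -/
theorem exists_residual_charpoly_eq [Finite (residueField p E)] {n : ℕ} (hn : n ≠ 0)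
    {M₁ M₂ : Matrix (Fin n) (Fin n) E} (hM : ‖M₁.det‖ = 1) (h : CongruentEigenvalues M₁ M₂) :
    ∃ (f₁ f₂ : (ringOfIntegers p E)[X]) (m : residueField p E),
      f₁.map (algebraMap (ringOfIntegers p E) E) = M₁.charpoly ∧
      f₂.map (algebraMap (ringOfIntegers p E) E) = M₂.charpoly ∧
      f₁.map (residue _) = (X - C m) ^ n ∧ f₂.map (residue _) = (X - C m) ^ n := by
  obtain ⟨F, _, _, _, -, -, ϖ, hϖ, l, a, hl, h1, h2⟩ := h
  let : NormedAlgebra ℚ_[p] F := NormedAlgebra.restrictScalars ℚ_[p] E F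
  have : IsUltrametricDist F := IsUltrametricDist.of_normedAlgebra ℚ_[p]
  have ha : a = 0 := by
    refine eq_zero_of_isCongruentToPow hn ?_ hϖ hl h1
    rw [← RingHom.mapMatrix_apply, ← RingHom.map_det, norm_algebraMap', hM]
  subst ha
  simp only [neg_zero, zpow_zero, one_smul] at h1 h2
  obtain ⟨f₁, hf₁⟩ := exists_lift_of_norm_coeff_le p (norm_charpoly_coeff_le h1)
  obtain ⟨f₂, hf₂⟩ := exists_lift_of_norm_coeff_le p (norm_charpoly_coeff_le h2)
  let j : ringOfIntegers p E →+* ringOfIntegers p F :=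
    { toFun := fun x => ⟨algebraMap E F x, (mem_ringOfIntegers p F _).mpr (by
        rw [norm_algebraMap']; exact (mem_ringOfIntegers p E _).mp x.2)⟩
      map_one' := by ext; simp
      map_mul' := fun a b => by ext; simp
      map_zero' := by ext; simp
      map_add' := fun a b => by ext; simp }
  have hj : IsLocalHom j := ⟨fun x hx => by
    rw [isUnit_ringOfIntegers_iff] at hx ⊢
    rwa [← norm_algebraMap' F]⟩
  let l' : ringOfIntegers p F := ⟨l, (mem_ringOfIntegers p F _).mpr hl.le⟩
  let : Algebra (residueField p E) (residueField p F) := (ResidueField.map j).toAlgebra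
  have key : ∀ (f : (ringOfIntegers p E)[X]) (M : Matrix (Fin n) (Fin n) E),
      f.map (algebraMap (ringOfIntegers p E) E) = M.charpoly →
      IsCongruentToPow (M.map (algebraMap E F)).charpoly l n →
      (f.map (residue _)).map (algebraMap (residueField p E) (residueField p F)) =
        (X - C (residue _ l')) ^ n := by
    intro f M hf hM
    have h3 : (f.map (residue _)).map (algebraMap (residueField p E) (residueField p F)) =
        (f.map j).map (residue _) := by
      rw [map_map, map_map]
      rfl
    rw [h3]
    refine residue_map_eq_of_isCongruentToPow p ?_
    have h4 : (f.map j).map (algebraMap (ringOfIntegers p F) F) =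
        (M.map (algebraMap E F)).charpoly := by
      rw [Matrix.charpoly_map, ← hf, map_map, map_map]
      rfl
    rwa [h4]
  obtain ⟨m, hm, hm1⟩ := exists_eq_X_sub_C_pow hn (key f₁ M₁ hf₁ h1)
  obtain ⟨m', hm', hm2⟩ := exists_eq_X_sub_C_pow hn (key f₂ M₂ hf₂ h2)
  have : m' = m := (algebraMap (residueField p E) (residueField p F)).injective (hm'.trans hm.symm)
  exact ⟨f₁, f₂, m, hf₁, hf₂, hm1, this ▸ hm2⟩

end IntegralCharpoly

/-! ### Lattices over the ring of integers -/

section Lattice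

open IsLocalRing

/-- Such a submodule is a continuous image of the compact space `O ^ r`. -/
theorem isClosed_of_fg {O B : Type*} [CommRing O] [TopologicalSpace O] [CompactSpace O]
    [AddCommGroup B] [TopologicalSpace B] [T2Space B] [ContinuousAdd B] [Module O B]
    [ContinuousSMul O B] (W : Submodule O B) (hW : W.FG) : IsClosed (W : Set B) := by
  obtain ⟨r, s, rfl⟩ := Submodule.fg_iff_exists_fin_generating_family.mp hW
  have h : ((Submodule.span O (Set.range s) : Submodule O B) : Set B) =
      Set.range fun c : Fin r → O => ∑ i, c i • s i := by
    ext x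
    rw [SetLike.mem_coe, Submodule.mem_span_range_iff_exists_fun]
    rfl
  rw [h]
  exact (isCompact_range (by fun_prop)).isClosed

/-- The range of `φ` is multiplicatively closed, so the algebra is its `O`-span, and the coordinate
bound puts it inside a lattice. Over a principal ideal domain it is then free, and an `O`-basis
stays independent over `E`. -/
theorem adjoin_range_isLattice {O E B G ι : Type*} [CommRing O] [IsDomain O]
    [IsPrincipalIdealRing O] [Field E] [Algebra O E] [IsFractionRing O E] [Ring B] [Algebra E B]
    [Algebra O B] [IsScalarTower O E B] [Group G] [Fintype ι] (b : Module.Basis ι E B)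
    (φ : G →* B) (c : E) (hc : ∀ g i, ∃ x : O, b.repr (φ g) i = algebraMap O E x * c) :
    Module.Finite O (Algebra.adjoin O (Set.range φ)) ∧
      Module.Free O (Algebra.adjoin O (Set.range φ)) ∧
      Module.finrank O (Algebra.adjoin O (Set.range φ)) ≤ Module.finrank E B := by
  set A := Algebra.adjoin O (Set.range φ) with hA
  have hspan : Subalgebra.toSubmodule A = Submodule.span O (Set.range φ) := by
    rw [hA, Algebra.adjoin_eq_span, ← MonoidHom.coe_mrange, Submonoid.closure_eq]
  have hle : Subalgebra.toSubmodule A ≤ Submodule.span O (Set.range fun i => c • b i) := by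
    rw [hspan, Submodule.span_le]
    rintro _ ⟨g, rfl⟩
    choose x hx using hc g
    rw [SetLike.mem_coe, Submodule.mem_span_range_iff_exists_fun]
    refine ⟨x, ?_⟩
    rw [← b.sum_repr (φ g)]
    refine Finset.sum_congr rfl fun i _ => ?_
    rw [hx, ← algebraMap_smul E (x i), smul_smul]
  have hfin : Module.Finite O A :=
    Module.Finite.iff_fg.mpr (Submodule.FG.of_le
      (Submodule.fg_span (Set.finite_range _)) hle : (Subalgebra.toSubmodule A).FG)
  have htf : Module.IsTorsionFree O B := Module.IsTorsionFree.trans_faithfulSMul O E B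
  have hfree : Module.Free O A := Module.free_of_finite_type_torsion_free'
  refine ⟨hfin, hfree, ?_⟩
  let e := Module.Free.chooseBasis O A
  have h1 : LinearIndependent O fun i => (e i : B) :=
    e.linearIndependent.map' (Subalgebra.val A).toLinearMap
      (LinearMap.ker_eq_bot.mpr Subtype.val_injective)
  rw [LinearIndependent.iff_fractionRing (R := O) (K := E)] at h1
  have : Module.Finite E B := Module.Finite.of_basis b
  rw [Module.finrank_eq_card_basis e]
  exact h1.fintype_card_le_finrank

theorem span_range_adjoin {O B G : Type*} [CommRing O] [Ring B] [Algebra O B] [Group G]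
    (φ : G →* B) : Submodule.span O (Set.range fun g =>
      (⟨φ g, Algebra.subset_adjoin ⟨g, rfl⟩⟩ : Algebra.adjoin O (Set.range φ))) = ⊤ := by
  refine Submodule.map_injective_of_injective
    (f := (Subalgebra.val (Algebra.adjoin O (Set.range φ))).toLinearMap) Subtype.val_injective ?_
  rw [Submodule.map_span, ← Set.range_comp, ← LinearMap.range_eq_map]
  have hspan : Subalgebra.toSubmodule (Algebra.adjoin O (Set.range φ)) =
      Submodule.span O (Set.range φ) := by
    rw [Algebra.adjoin_eq_span, ← MonoidHom.coe_mrange, Submonoid.closure_eq]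
  refine Eq.trans (b := Subalgebra.toSubmodule (Algebra.adjoin O (Set.range φ))) hspan.symm ?_
  ext x
  simp

variable (p : ℕ) [Fact p.Prime] (E : Type u) [NormedField E] [NormedAlgebra ℚ_[p] E]

theorem compactSpace_ringOfIntegers [FiniteDimensional ℚ_[p] E] : CompactSpace (ringOfIntegers p E) := by
  have : ProperSpace E := FiniteDimensional.proper ℚ_[p] E
  refine isCompact_iff_compactSpace.mp ?_
  convert isCompact_closedBall (0 : E) 1
  ext x
  simp [mem_ringOfIntegers]

theorem isPrincipalIdealRing_ringOfIntegers [FiniteDimensional ℚ_[p] E] :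
    IsPrincipalIdealRing (ringOfIntegers p E) := by
  have : IsUltrametricDist E := IsUltrametricDist.of_normedAlgebra ℚ_[p]
  let : Valued E ℝ≥0 := NormedField.toValued
  have h : CompactSpace (Valued.v (R := E) (Γ₀ := ℝ≥0)).integer := compactSpace_ringOfIntegers p E
  have h2 : IsPrincipalIdealRing (Valued.v (R := E) (Γ₀ := ℝ≥0)).integer :=
    Valued.integer.isPrincipalIdealRing_of_compactSpace
  exact h2

theorem charP_residueField : CharP (residueField p E) p := by
  refine (CharP.charP_iff_prime_eq_zero (Fact.out : p.Prime)).mpr ?_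
  have h : ((p : ℕ) : ringOfIntegers p E) ∈ maximalIdeal (ringOfIntegers p E) := by
    rw [mem_maximalIdeal_ringOfIntegers_iff]
    have h2 : ‖(algebraMap ℚ_[p] E) p‖ < 1 := by
      rw [norm_algebraMap']
      exact Padic.norm_p_lt_one
    simpa using h2
  rw [← residue_eq_zero_iff] at h
  simpa using h

instance continuousSMul_ringOfIntegers : ContinuousSMul (ringOfIntegers p E) E :=
  ⟨(continuous_subtype_val.comp continuous_fst).mul continuous_snd⟩

end Lattice

/-! ### Pairs of representations with congruent eigenvalues -/

section CongruentRepresentations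

open IsLocalRing Polynomial

/-- A value of norm above one would have unbounded powers on a compact group; the same applies to
inverses. -/
theorem norm_eq_one_of_continuous {G E : Type*} [Group G] [TopologicalSpace G] [CompactSpace G]
    [NormedField E] (f : G →* Eˣ) (hf : Continuous fun g => (f g : E)) (g : G) :
    ‖(f g : E)‖ = 1 := by
  obtain ⟨C, hC⟩ := isCompact_univ.exists_bound_of_continuousOn hf.continuousOn
  have hle : ∀ g, ‖(f g : E)‖ ≤ 1 := fun g => by
    by_contra! h
    obtain ⟨m, hm⟩ := pow_unbounded_of_one_lt C h
    have := hC (g ^ m) trivial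
    rw [map_pow, Units.val_pow_eq_pow_val, norm_pow] at this
    exact absurd this (not_le.mpr hm)
  refine le_antisymm (hle g) ?_
  have h1 := hle g⁻¹
  rw [map_inv, Units.val_inv_eq_inv_val, norm_inv] at h1
  have h0 : 0 < ‖(f g : E)‖ := norm_pos_iff.mpr (f g).ne_zero
  rwa [inv_le_one₀ h0] at h1

/-- `Nat.card` of an infinite type is `0`, and only `1` is coprime to `0`. -/
theorem finite_of_coprime_card_units {k : Type*} [Field k] {n : ℕ} (hn : 2 ≤ n)
    (h : Nat.Coprime n (Nat.card kˣ)) : Finite k := by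
  have hfin : Finite kˣ := by
    refine (Nat.card_ne_zero.mp fun h0 => ?_).2
    rw [h0, Nat.coprime_zero_right] at h
    omega
  refine Set.finite_univ_iff.mp (((Set.finite_range (Units.val : kˣ → k)).insert 0).subset ?_)
  intro x _
  rcases eq_or_ne x 0 with rfl | hx
  · exact Set.mem_insert _ _
  · exact Set.mem_insert_of_mem _ ⟨Units.mk0 x hx, rfl⟩

variable (p : ℕ) [Fact p.Prime] {E : Type u} [NormedField E] [NormedAlgebra ℚ_[p] E]
  {n : ℕ} {G : Type v} [TopologicalSpace G] [CompactSpace G]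

/-- The `n`-th power of the residual eigenvalue is the reduced determinant, hence multiplicative.
Coprimality makes the `n`-th power map injective on units, so the eigenvalue itself is
multiplicative. -/
theorem exists_residual_character [Group G] (hn : 2 ≤ n)
    (hcop : Nat.Coprime n (Nat.card (residueField p E)ˣ)) (ρ₁ ρ₂ : G →* GL (Fin n) E)
    (hρ₁ : Continuous ρ₁) (hcong : ∀ g, CongruentEigenvalues
      (ρ₁ g : Matrix (Fin n) (Fin n) E) (ρ₂ g : Matrix (Fin n) (Fin n) E)) :
    ∃ χ : G →* (residueField p E)ˣ, ∀ g, ∃ f₁ f₂ : (ringOfIntegers p E)[X],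
      f₁.map (algebraMap (ringOfIntegers p E) E) = (ρ₁ g : Matrix (Fin n) (Fin n) E).charpoly ∧
      f₂.map (algebraMap (ringOfIntegers p E) E) = (ρ₂ g : Matrix (Fin n) (Fin n) E).charpoly ∧
      f₁.map (residue _) = (X - C (χ g : residueField p E)) ^ n ∧
      f₂.map (residue _) = (X - C (χ g : residueField p E)) ^ n := by
  have hfin := finite_of_coprime_card_units hn hcop
  have hdet : ∀ g, ‖(ρ₁ g : Matrix (Fin n) (Fin n) E).det‖ = 1 :=
    norm_eq_one_of_continuous (Matrix.GeneralLinearGroup.det.comp ρ₁)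
      (Continuous.matrix_det (Units.continuous_val.comp hρ₁))
  choose f₁ f₂ m h1 h2 h3 h4 using fun g =>
    exists_residual_charpoly_eq p (by omega) (hdet g) (hcong g)
  let d : G →* ringOfIntegers p E :=
    { toFun := fun g => ⟨(ρ₁ g : Matrix (Fin n) (Fin n) E).det,
        (mem_ringOfIntegers p E _).mpr (hdet g).le⟩
      map_one' := by ext; simp
      map_mul' := fun a b => by ext; simp }
  have hm : ∀ g, m g ^ n = residue _ (d g) := fun g => by
    have e1 : d g = (-1) ^ n * (f₁ g).coeff 0 := by
      apply Subtype.ext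
      have e2 := congrArg (fun f : E[X] => f.coeff 0) (h1 g)
      rw [coeff_map] at e2
      change (ρ₁ g : Matrix (Fin n) (Fin n) E).det = _
      rw [Matrix.det_eq_sign_charpoly_coeff, Fintype.card_fin, ← e2]
      simp
    have e3 := congrArg (fun f : (residueField p E)[X] => f.coeff 0) (h3 g)
    rw [coeff_map] at e3
    rw [e1, map_mul, e3, coeff_zero_eq_eval_zero]
    simp [← mul_pow]
  let D : G →* (residueField p E)ˣ := ((residue _).toMonoidHom.comp d).toHomUnits
  have hD : ∀ g, ((D g : (residueField p E)ˣ) : residueField p E) = residue _ (d g) := fun _ => rfl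
  have hm0 : ∀ g, m g ≠ 0 := fun g h0 => by
    have e := hm g
    rw [h0, zero_pow (by omega), ← hD] at e
    exact (D g).ne_zero e.symm
  have hbij := hcop.symm.pow_left_bijective
  refine ⟨MonoidHom.mk' (fun g => Units.mk0 (m g) (hm0 g)) fun a b => hbij.injective ?_,
    fun g => ⟨f₁ g, f₂ g, h1 g, h2 g, h3 g, h4 g⟩⟩
  ext
  simp [mul_pow, hm]

theorem exists_norm_bound [FiniteDimensional ℚ_[p] E] {ι : Type*} [Finite ι] (f : ι → G → E)
    (hf : ∀ i, Continuous (f i)) :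
    ∃ c : E, ∀ g i, ∃ x : ringOfIntegers p E, f i g = algebraMap _ E x * c := by
  have := Fintype.ofFinite ι
  choose C hC using fun i => isCompact_univ.exists_bound_of_continuousOn (hf i).continuousOn
  obtain ⟨x, hx⟩ := NormedField.exists_lt_norm ℚ_[p] (∑ i, |C i|)
  have hx0 : 0 < ‖x‖ := lt_of_le_of_lt (Finset.sum_nonneg fun i _ => abs_nonneg _) hx
  have hc0 : algebraMap ℚ_[p] E x ≠ 0 := by simpa using hx0
  refine ⟨algebraMap ℚ_[p] E x, fun g i => ⟨⟨f i g / algebraMap ℚ_[p] E x,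
    (mem_ringOfIntegers p E _).mpr ?_⟩, (div_mul_cancel₀ _ hc0).symm⟩⟩
  rw [norm_div, norm_algebraMap', div_le_one hx0]
  exact (hC i g trivial).trans ((le_abs_self _).trans ((Finset.single_le_sum
    (fun i _ => abs_nonneg (C i)) (Finset.mem_univ i)).trans hx.le))

/-- Both representations are handled at once inside the product of two matrix algebras, whose
dimension `2 * n ^ 2` bounds the rank of the order they generate. -/
theorem exists_subgroups_of_congruentEigenvalues [Group G] [FiniteDimensional ℚ_[p] E] (hn : 2 ≤ n)
    (hcop : Nat.Coprime n (Nat.card (residueField p E)ˣ)) (ρ₁ ρ₂ : G →* GL (Fin n) E)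
    (hρ₁ : Continuous ρ₁) (hρ₂ : Continuous ρ₂) (hcong : ∀ g, CongruentEigenvalues
      (ρ₁ g : Matrix (Fin n) (Fin n) E) (ρ₂ g : Matrix (Fin n) (Fin n) E)) :
    ∃ U : ℕ → Subgroup G, (∀ i, IsClosed (U i : Set G)) ∧ U 0 = ⊤ ∧
      (∀ i, ∀ g ∈ U i, ∀ h ∈ U i, g * h * g⁻¹ * h⁻¹ ∈ U (i + 1)) ∧
      (∀ i, ∀ g ∈ U i, g ^ p ∈ U (i + 1)) ∧ (∀ i, ρ₁.ker ⊓ ρ₂.ker ≤ U i) ∧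
      ∀ h, 2 * n ^ 2 ≤ 2 ^ h →
        (∀ g, ∃ f, g * f⁻¹ ∈ U h ∧ (ρ₁ f : Matrix (Fin n) (Fin n) E).trace =
          (ρ₂ f : Matrix (Fin n) (Fin n) E).trace) →
        ∀ g, (ρ₁ g : Matrix (Fin n) (Fin n) E).trace =
          (ρ₂ g : Matrix (Fin n) (Fin n) E).trace := by
  obtain ⟨χ, hχ⟩ := exists_residual_character p hn hcop ρ₁ ρ₂ hρ₁ hcong
  have := isPrincipalIdealRing_ringOfIntegers p E
  have := compactSpace_ringOfIntegers p E
  have := charP_residueField p E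
  have hfin := finite_of_coprime_card_units hn hcop
  have : NeZero n := ⟨by omega⟩
  let O := ringOfIntegers p E
  let B := Matrix (Fin n) (Fin n) E × Matrix (Fin n) (Fin n) E
  let Φ : G →* B := ((Units.coeHom _).comp ρ₁).prod ((Units.coeHom _).comp ρ₂)
  have hΦ : Continuous Φ :=
    (Units.continuous_val.comp hρ₁).prodMk (Units.continuous_val.comp hρ₂)
  let b : Module.Basis ((Fin n × Fin n) ⊕ (Fin n × Fin n)) E B :=
    (Matrix.stdBasis E (Fin n) (Fin n)).prod (Matrix.stdBasis E (Fin n) (Fin n))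
  have hb : ∀ i, Continuous fun g => b.repr (Φ g) i := by
    rintro (⟨i, j⟩ | ⟨i, j⟩)
    · have : (fun g => b.repr (Φ g) (.inl (i, j))) = fun g => (Φ g).1 i j := by
        ext g
        rfl
      rw [this]
      exact hΦ.fst.matrix_elem i j
    · have : (fun g => b.repr (Φ g) (.inr (i, j))) = fun g => (Φ g).2 i j := by
        ext g
        rfl
      rw [this]
      exact hΦ.snd.matrix_elem i j
  obtain ⟨c, hc⟩ := exists_norm_bound p (fun i g => b.repr (Φ g) i) hb
  have hrank : Module.finrank E B = 2 * n ^ 2 := by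
    rw [Module.finrank_prod, Module.finrank_matrix]
    simp
    ring
  obtain ⟨hAfin, hAfree, hArank⟩ := adjoin_range_isLattice (O := O) b Φ c hc
  set A := Algebra.adjoin O (Set.range Φ) with hA
  let φ : G →* A := Φ.codRestrict A fun g => Algebra.subset_adjoin ⟨g, rfl⟩
  have hφ : Submodule.span O (Set.range φ) = ⊤ := span_range_adjoin Φ
  have hnil : ∀ g, IsNilpotent (TensorProduct.tmul O (1 : ResidueField O) (φ g) -
      algebraMap (ResidueField O) (TensorProduct O (ResidueField O) A) (χ g)) := by
    intro g
    obtain ⟨f₁, f₂, h1, h2, h3, h4⟩ := hχ g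
    -- By Cayley–Hamilton `f₁` kills the first component and `f₂` the second; their product kills
    -- the pair and reduces to a `2n`-th power of a linear factor.
    refine isNilpotent_one_tmul_sub (P := f₁ * f₂) (m := n + n) ?_ ?_
    · have key : ∀ (f : O[X]) (M : Matrix (Fin n) (Fin n) E),
          f.map (algebraMap O E) = M.charpoly → aeval M f = 0 := fun f M hf => by
        rw [← aeval_map_algebraMap E, hf, Matrix.aeval_self_charpoly]
      apply Subtype.ext
      have e1 : ((aeval (φ g) (f₁ * f₂) : A) : B) = aeval (Φ g) (f₁ * f₂) :=
        (aeval_algHom_apply A.val (φ g) (f₁ * f₂)).symm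
      rw [e1]
      refine Prod.ext ?_ ?_
      · refine (aeval_algHom_apply (AlgHom.fst O _ _) (Φ g) (f₁ * f₂)).symm.trans ?_
        rw [map_mul]
        refine mul_eq_zero_of_left ?_ _
        exact key _ _ h1
      · refine (aeval_algHom_apply (AlgHom.snd O _ _) (Φ g) (f₁ * f₂)).symm.trans ?_
        rw [map_mul]
        refine mul_eq_zero_of_right _ ?_
        exact key _ _ h2
    · rw [Polynomial.map_mul, h3, h4, pow_add]
  obtain ⟨U, hU0, hUc, hUp, hUm, hUt⟩ := exists_unipotent_subgroups (N := E) p φ hφ χ hnil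
    (hArank.trans hrank.le)
  refine ⟨U, ?_, hU0, hUc, hUp, ?_, ?_⟩
  · intro i
    have : Finite (O ⧸ maximalIdeal O) := hfin
    have : Finite (A ⧸ (⊤ : Submodule O A)) := inferInstance
    have hfinq : Finite (A ⧸ (maximalIdeal O • (⊤ : Submodule O A))) :=
      Submodule.finite_quotient_smul _ hAfin.fg_top
    have hcl : IsClosed (((maximalIdeal O • (⊤ : Submodule O A)).map A.val.toLinearMap :
        Submodule O B) : Set B) := by
      refine isClosed_of_fg _ (Submodule.FG.map _ ?_)
      exact IsNoetherian.noetherian _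
    let mk : A → A ⧸ (maximalIdeal O • (⊤ : Submodule O A)) := Submodule.Quotient.mk
    have hU : (U i : Set G) = ⋃ q ∈ {q | ∃ g ∈ U i, mk (φ g) = q}, {g | mk (φ g) = q} := by
      ext g
      simp only [SetLike.mem_coe, Set.mem_ofPred_eq, Set.mem_iUnion]
      refine ⟨fun hg => ⟨_, ⟨g, hg, rfl⟩, rfl⟩, ?_⟩
      rintro ⟨_, ⟨g', hg', rfl⟩, hg⟩
      exact hUm i g' g ((Submodule.Quotient.eq _).mp hg.symm) hg'
    rw [hU]
    refine (Set.toFinite _).isClosed_biUnion ?_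
    rintro _ ⟨g, -, rfl⟩
    have hpre : {g' | mk (φ g') = mk (φ g)} = (fun g' => Φ g' - Φ g) ⁻¹'
        (((maximalIdeal O • (⊤ : Submodule O A)).map A.val.toLinearMap : Submodule O B) : Set B) := by
      ext g'
      refine (Submodule.Quotient.eq _).trans ⟨fun hg => ⟨_, hg, rfl⟩, ?_⟩
      rintro ⟨a, ha, hag⟩
      have : a = φ g' - φ g := Subtype.ext hag
      exact this ▸ ha
    rw [hpre]
    exact hcl.preimage (hΦ.sub continuous_const)
  · rintro i g ⟨h1, h2⟩
    refine hUm i 1 g ?_ (one_mem _)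
    have : φ g = φ 1 := by
      apply Subtype.ext
      change Φ g = Φ 1
      refine Prod.ext ?_ ?_
      · change (ρ₁ g : Matrix (Fin n) (Fin n) E) = ρ₁ 1
        rw [MonoidHom.mem_ker.mp h1, map_one]
      · change (ρ₂ g : Matrix (Fin n) (Fin n) E) = ρ₂ 1
        rw [MonoidHom.mem_ker.mp h2, map_one]
    rw [this, sub_self]
    exact zero_mem _
  · intro h hh hf g
    let t : Matrix (Fin n) (Fin n) E →ₗ[O] E := (Matrix.traceLinearMap (Fin n) E E).restrictScalars O
    let δ : A →ₗ[O] E := (t.comp (LinearMap.fst O _ _) - t.comp (LinearMap.snd O _ _)).comp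
      A.val.toLinearMap
    have hδ : ∀ g, δ (φ g) = (ρ₁ g : Matrix (Fin n) (Fin n) E).trace -
      (ρ₂ g : Matrix (Fin n) (Fin n) E).trace := fun g => rfl
    have h0 := hUt h hh δ fun g => by
      obtain ⟨f, hf1, hf2⟩ := hf g
      exact ⟨f, hf1, by rw [hδ, hf2, sub_self]⟩
    rw [← sub_eq_zero, ← hδ, h0, LinearMap.zero_apply]

end CongruentRepresentations

/-! ### The comparison of the two representations -/

section Comparison

/-- A cyclic group `⟨t⟩` containing `g` with `t` of largest order is maximal. A bound on the
exponent suffices for such a `t` to exist, so the group need not be finite. -/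
theorem exists_maximal_isCyclic {G : Type*} [Group G] {m : ℕ} (hm : 0 < m)
    (h : ∀ g : G, g ^ m = 1) (g : G) :
    ∃ C : Subgroup G, Maximal (fun D : Subgroup G => IsCyclic D) C ∧ g ∈ C := by
  set s : Set ℕ := {j | ∃ t : G, g ∈ Subgroup.zpowers t ∧ orderOf t = j} with hs
  have hbdd : BddAbove s := by
    refine ⟨m, ?_⟩
    rintro _ ⟨t, -, rfl⟩
    exact Nat.le_of_dvd hm (orderOf_dvd_of_pow_eq_one (h t))
  obtain ⟨t, ht, hmax⟩ := Nat.sSup_mem (s := s) ⟨_, g, Subgroup.mem_zpowers g, rfl⟩ hbdd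
  refine ⟨Subgroup.zpowers t, ⟨inferInstance, ?_⟩, ht⟩
  intro D hD hle
  obtain ⟨⟨d, hd⟩, hgen⟩ := hD.exists_generator
  have hDd : D = Subgroup.zpowers d := by
    refine le_antisymm (fun x hx => ?_) (Subgroup.zpowers_le.mpr hd)
    obtain ⟨j, hj⟩ := hgen ⟨x, hx⟩
    exact ⟨j, by simpa using congrArg Subtype.val hj⟩
  have hcard : orderOf d ≤ orderOf t := by
    rw [hmax]
    exact le_csSup hbdd ⟨d, hDd ▸ hle ht, rfl⟩
  have hfin : IsOfFinOrder d := isOfFinOrder_iff_pow_eq_one.mpr ⟨m, hm, h d⟩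
  have : Finite (Subgroup.zpowers d) := hfin.finite_zpowers
  rw [hDd] at hle ⊢
  refine (Subgroup.eq_of_le_of_card_ge hle ?_).ge
  rwa [Nat.card_zpowers, Nat.card_zpowers]

/-- The `λ` steps alone suffice, because `2 * n ^ 2 ≤ r ≤ 2 ^ λ`. -/
theorem two_mul_sq_le_two_pow_towerHeight (p : ℕ) [Fact p.Prime] {k : Type*} [Field k] [CharP k p]
    {n d : ℕ} (hn : 2 ≤ n) (hd : 0 < d) (h : Nat.Coprime n (Nat.card kˣ)) :
    2 * n ^ 2 ≤ 2 ^ towerHeight p n (n * d) := by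
  have hN : n ≤ n * d := Nat.le_mul_of_pos_right n hd
  set N := n * d
  have hle : ∀ ε r : ℕ, 2 * n ^ 2 ≤ r → 2 * n ^ 2 ≤ 2 ^ (Nat.clog 2 r + ε + Nat.clog p n) := by
    intro ε r hr
    refine (hr.trans (Nat.le_pow_clog one_lt_two r)).trans (Nat.pow_le_pow_right two_pos ?_)
    omega
  refine hle _ _ ?_
  by_cases hp : p = 2
  · rw [if_pos hp]
    have h1 : 1 ≤ N * (N - 1) / 2 := by
      rw [Nat.le_div_iff_mul_le two_pos]
      nlinarith [Nat.sub_add_cancel (show 1 ≤ N by omega)]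
    calc 2 * n ^ 2 ≤ n ^ 2 * n ^ 2 := Nat.mul_le_mul_right _ (by nlinarith)
      _ ≤ N ^ 2 * N ^ 2 := by gcongr
      _ = N ^ (2 * (1 + 1)) * 1 := by ring
      _ ≤ _ := Nat.mul_le_mul_left _ h1
  · rw [if_neg hp]
    -- For `n = 2` coprimality would make squaring injective on `kˣ`, forcing `-1 = 1` and so `p =
    -- 2`.
    have hn3 : 3 ≤ n := by
      by_contra hlt
      obtain rfl : n = 2 := by omega
      have h1 : (-1 : kˣ) = 1 := h.symm.pow_left_bijective.injective (by simp)
      have h2 : (-1 : k) = 1 := by simpa using congrArg Units.val h1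
      have h3 : ((2 : ℕ) : k) = 0 := by
        push_cast
        linear_combination -h2
      rw [CharP.cast_eq_zero_iff k p] at h3
      exact hp ((Nat.prime_dvd_prime_iff_eq Fact.out Nat.prime_two).mp h3)
    have h1 : 3 ≤ N * (N - 1) / 2 := by
      rw [Nat.le_div_iff_mul_le two_pos]
      nlinarith [Nat.sub_add_cancel (show 1 ≤ N by omega)]
    calc 2 * n ^ 2 ≤ N ^ 2 * 3 := by nlinarith
      _ ≤ _ := by simpa using Nat.mul_le_mul_left _ h1

theorem moduleTrace_toRep {G : Type v} [Group G] {E : Type w} [Field E] {n : ℕ}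
    (ρ : G →* GL (Fin n) E) (a : MonoidAlgebra E G) :
    moduleTrace E (toRep ρ).asModule a =
      LinearMap.trace E (Fin n → E) ((toRep ρ).asAlgebraHom a) := rfl

theorem moduleTrace_toRep_eq {G : Type v} [Group G] {E : Type w} [Field E] {n : ℕ}
    {ρ₁ ρ₂ : G →* GL (Fin n) E} (h : ∀ g, (ρ₁ g : Matrix (Fin n) (Fin n) E).trace =
      (ρ₂ g : Matrix (Fin n) (Fin n) E).trace) (a : MonoidAlgebra E G) :
    moduleTrace E (toRep ρ₁).asModule a = moduleTrace E (toRep ρ₂).asModule a := by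
  rw [moduleTrace_toRep, moduleTrace_toRep]
  have hs : ∀ (ρ : G →* GL (Fin n) E) (g : G),
      LinearMap.trace E (Fin n → E) (toRep ρ g) = (ρ g : Matrix (Fin n) (Fin n) E).trace :=
    fun ρ g => Matrix.trace_toLin'_eq _
  induction a using MonoidAlgebra.induction_linear with
  | zero => simp
  | add f g hf hg => simp only [map_add, hf, hg]
  | single g r => simp [Representation.asAlgebraHom_single, hs, h]

variable {K : Type u} [Field K] {Kb : Type v} [Field Kb] [Algebra K Kb] [IsSepClosure K Kb]

/-- The group of the `i`-th step has exponent dividing `p ^ i`, so the image of `g` lies in a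
maximal cyclic subgroup. Its Frobenius generator lifts to a Frobenius element of `Kb`, and finite
order allows a natural exponent `j`. -/
theorem exists_isFrobenius_pow (S T : Set (Place K)) (p i : ℕ) (hp : 0 < p)
    (hT : ∀ C : Subgroup (tower Kb S p i ≃ₐ[K] tower Kb S p i),
      Maximal (fun D : Subgroup (tower Kb S p i ≃ₐ[K] tower Kb S p i) => IsCyclic D) C →
      ∃ t ∈ T, ∃ (y : Place (tower Kb S p i)) (σ : tower Kb S p i ≃ₐ[K] tower Kb S p i),
        y.IsFrobenius t σ ∧ Subgroup.zpowers σ = C) (g : Kb ≃ₐ[K] Kb) :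
    ∃ t ∈ T, ∃ (y : Place Kb) (f : Kb ≃ₐ[K] Kb) (j : ℕ), y.IsFrobenius t f ∧
      g * (f ^ j)⁻¹ ∈ (tower Kb S p i).fixingSubgroup := by
  have : IsGalois K Kb := IsSepClosure.isGalois
  have := normal_tower (Kb := Kb) S p i
  let r : (Kb ≃ₐ[K] Kb) →* (tower Kb S p i ≃ₐ[K] tower Kb S p i) :=
    AlgEquiv.restrictNormalHom (tower Kb S p i)
  have hker : r.ker = (tower Kb S p i).fixingSubgroup := IntermediateField.restrictNormalHom_ker _
  have hexp : ∀ σ : tower Kb S p i ≃ₐ[K] tower Kb S p i, σ ^ p ^ i = 1 := by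
    intro σ
    obtain ⟨g, rfl⟩ : ∃ g, r g = σ := AlgEquiv.restrictNormalHom_surjective Kb σ
    rw [← map_pow, ← MonoidHom.mem_ker, hker]
    exact pow_mem_fixingSubgroup_tower S p i g
  obtain ⟨C, hC, hgC⟩ := exists_maximal_isCyclic (pow_pos hp i) hexp (r g)
  obtain ⟨t, ht, y, σ, hσ, rfl⟩ := hT C hC
  obtain ⟨z, f, hf, hfσ⟩ := Place.exists_lift_isFrobenius (L := Kb) hσ
  have hrf : r f = σ := by
    ext a
    exact (AlgEquiv.restrictNormal_commutes f (tower Kb S p i) a).trans (hfσ a)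
  have hfin : IsOfFinOrder σ := isOfFinOrder_iff_pow_eq_one.mpr ⟨_, pow_pos hp i, hexp σ⟩
  obtain ⟨j, hj⟩ := hfin.mem_powers_iff_mem_zpowers.mpr hgC
  refine ⟨t, ht, z, f, j, hf, ?_⟩
  rw [← hker, MonoidHom.mem_ker, map_mul, map_inv, map_pow, hrf, ← hj]
  exact mul_inv_cancel _

end Comparison

end GaloisCriterion

theorem theorem3
    (n : ℕ) (hn : 2 ≤ n) (p : ℕ) [Fact p.Prime]
    (K : Type u) [Field K] (hK : GaloisCriterion.IsGlobalField K)
    (Kb : Type v) [Field Kb] [Algebra K Kb] [IsSepClosure K Kb]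
    (S : Set (GaloisCriterion.Place K)) (hS : S.Finite)
    (E : Type w) [NormedField E] [NormedAlgebra ℚ_[p] E] [FiniteDimensional ℚ_[p] E]
    (hcop : Nat.Coprime n (Nat.card (GaloisCriterion.residueField p E)ˣ))
    (T : Set (GaloisCriterion.Place K)) (hTS : Disjoint T S)
    (hT : ∀ C : Subgroup
        (GaloisCriterion.fieldKS Kb S p n (Module.finrank ℚ_[p] E) ≃ₐ[K]
          GaloisCriterion.fieldKS Kb S p n (Module.finrank ℚ_[p] E)),
      Maximal (fun D : Subgroup
        (GaloisCriterion.fieldKS Kb S p n (Module.finrank ℚ_[p] E) ≃ₐ[K]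
          GaloisCriterion.fieldKS Kb S p n (Module.finrank ℚ_[p] E)) => IsCyclic D) C →
      ∃ t ∈ T, ∃ (y : GaloisCriterion.Place
          (GaloisCriterion.fieldKS Kb S p n (Module.finrank ℚ_[p] E)))
        (σ : GaloisCriterion.fieldKS Kb S p n (Module.finrank ℚ_[p] E) ≃ₐ[K]
          GaloisCriterion.fieldKS Kb S p n (Module.finrank ℚ_[p] E)),
        y.IsFrobenius t σ ∧ Subgroup.zpowers σ = C)
    (ρ₁ ρ₂ : (Kb ≃ₐ[K] Kb) →* GL (Fin n) E)
    (hρ₁ : Continuous ρ₁) (hρ₂ : Continuous ρ₂)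
    (hur₁ : GaloisCriterion.IsUnramifiedRep S ρ₁)
    (hur₂ : GaloisCriterion.IsUnramifiedRep S ρ₂)
    (hcong : ∀ σ : Kb ≃ₐ[K] Kb, GaloisCriterion.CongruentEigenvalues
      (ρ₁ σ : Matrix (Fin n) (Fin n) E) (ρ₂ σ : Matrix (Fin n) (Fin n) E))
    (hfrob : ∀ t ∈ T, ∀ (y : GaloisCriterion.Place Kb) (σ : Kb ≃ₐ[K] Kb),
      y.IsFrobenius t σ →
        (ρ₁ σ : Matrix (Fin n) (Fin n) E).charpoly =
          (ρ₂ σ : Matrix (Fin n) (Fin n) E).charpoly) :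
    GaloisCriterion.IsoSemisimplifications (MonoidAlgebra E (Kb ≃ₐ[K] Kb))
      (GaloisCriterion.toRep ρ₁).asModule (GaloisCriterion.toRep ρ₂).asModule := by

  have : IsGalois K Kb := IsSepClosure.isGalois
  have hchar := GaloisCriterion.charP_residueField p E
  have : CharZero E := charZero_of_injective_algebraMap (algebraMap ℚ_[p] E).injective
  obtain ⟨U, hclosed, h0, hcomm, hpow, hker, htrace⟩ :=
    GaloisCriterion.exists_subgroups_of_congruentEigenvalues p hn hcop ρ₁ ρ₂ hρ₁ hρ₂ hcong
  have hheight := GaloisCriterion.two_mul_sq_le_two_pow_towerHeight p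
    (k := GaloisCriterion.residueField p E) hn
    (Module.finrank_pos (R := ℚ_[p]) (M := E)) hcop
  have htower := GaloisCriterion.fixingSubgroup_tower_le S p U hclosed h0 hcomm hpow
    fun i x hx z hz => (le_inf (hur₁ x hx z hz) (hur₂ x hx z hz)).trans (hker i)
  refine GaloisCriterion.isoSemisimplifications_of_moduleTrace_eq (E := E)
    (GaloisCriterion.moduleTrace_toRep_eq (htrace _ hheight fun g => ?_))
  obtain ⟨t, ht, y, f, j, hf, hgf⟩ := GaloisCriterion.exists_isFrobenius_pow S T p _
    (Fact.out : p.Prime).pos hT g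
  refine ⟨f ^ j, htower _ hgf, ?_⟩
  -- The comparison element `f ^ j` is only a power of a Frobenius element, so the equality of full
  -- characteristic polynomials at `f` is used, not just that of traces.
  have h := GaloisCriterion.trace_pow_eq_of_charpoly_eq (hfrob t ht y f hf) j
  simpa using h
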